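/- Consider the fine-grain call-by-value calculus of algebraic effect handlers with values $v ::= x \mid () \mid \mathtt{true} \mid \mathtt{false} \mid \mathtt{fun}\,x \mapsto c \mid \mathtt{handler}\,(\mathtt{return}\,x\mapsto c_r; h)$, computations $c ::= \mathtt{if}\,v\,\mathtt{then}\,c_1\,\mathtt{else}\,c_2 \mid v_1\,v_2 \mid \mathtt{return}\,v \mid op(v;y.c) \mid \mathtt{do}\,x\leftarrow c_1\,\mathtt{in}\,c_2 \mid \mathtt{with}\,v\,\mathtt{handle}\,c$ and operation clauses $h=\{op(x;k)\mapsto c_{op}\}_{op}$ (closed, deep handlers), value types $A ::= \mathtt{unit}\mid\mathtt{bool}\mid A\to \underline C\mid \underline C\Rightarrow\underline D$ and computation types $\underline C ::= A!\Sigma/\mathcal E$, where $\Sigma$ is a finite set of typed operations $op : A_{op}\to B_{op}$ with distinct names and $\mathcal E$ is a finite set of equations $\Gamma';Z\vdash T_1\sim T_2$ between templates $T::= z(v)\mid \mathtt{if}\,v\,\mathtt{then}\,T_1\,\mathtt{else}\,T_2\mid op(v;y.T)$ over $\Sigma$. A handler has type $A!\Sigma/\mathcal E\Rightarrow\underline D$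 only if its clauses respect $\mathcal E$, written $\Gamma\vdash h:\Sigma\rightharpoonup\underline D$ respects $\mathcal E$. The predicate logic $\mathcal L_{\mathrm{pred}}$ is defined simultaneously with the type system. Formulae are built from $v_1\equiv_A v_2$ and $c_1\equiv_{\underline C}c_2$ by $\top,\bot,\wedge,\vee,\Rightarrow,\forall x{:}A,\exists x{:}A$. The rules of $\Gamma\mid\Psi\vdash\varphi$ are: structural rules and substitution, equivalence and congruence rules, the $\beta\eta$-rules, instances of the equations of $\mathcal E$ at type $A!\Sigma/\mathcal E$, the rules of classical first-order logic, and induction on computations (to prove $\varphi(c)$ for $c:A!\Sigma/\mathcal E$, prove $\varphi(\mathtt{return}\,x)$, and for each $op:A_{op}\to B_{op}$ in $\Sigma$ prove $\varphi(op(x;y.k\,y))$ from $\forall y{:}B_{op}.\,\varphi(k\,y)$). Clauses $h$ with $\Gamma\vdash h:\Sigma\rightharpoonup\underline D$ respect $\emptyset$; and they respect $\mathcal E\cup\{(x_i{:}A_i)_i;(z_j{:}B_j\to *)_j\vdash T_1\sim T_2\}$ if they respect $\mathcal E$ and $\Gamma,(x_i{:}A_i)_i,(f_j{:}B_j\to\underline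 D)_j\mid\ \vdash T_1^h[f_j/z_j]_j\equiv_{\underline D}T_2^h[f_j/z_j]_j$ is derivable, where $T^h$ handles each operation call of $T$ by its clause in $h$. Semantics. Types denote sets, disregarding theories: $[\![\mathtt{unit}]\!]=\{\star\}$, $[\![\mathtt{bool}]\!]=\{\mathrm{ff},\mathrm{tt}\}$, $[\![A\to\underline C]\!]=[\![A]\!]\to[\![\underline C]\!]$, $[\![\underline C\Rightarrow\underline D]\!]=[\![\underline C]\!]\to[\![\underline D]\!]$, and $[\![A!\Sigma/\mathcal E]\!]$ is the set of trees inductively generated by $\mathrm{in}_{\mathtt{return}}(a)$ and $\mathrm{in}_{op}(a;\kappa)$. Well-typed terms denote maps on $[\![\Gamma]\!]$ in the usual way; clauses $h$ denote at $\eta$ an interpretation $[\![h]\!]\eta$ of $\Sigma$ over $[\![\underline D]\!]$, and a template $T$ denotes, for each interpretation $H$ over a set $Y$, a map $[\![T]\!]_H$ into $Y$. The relations $\sim_A$ are equality on $\mathtt{unit}$ and $\mathtt{bool}$ and are logical (related arguments to related results) on function and handler types, $\sim_\Gamma$ is componentwise, and $\sim_{A!\Sigma/\mathcal E}$ is the smallest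 symmetric and transitive relation closed under $\mathrm{in}_{\mathtt{return}}$ and $\mathrm{in}_{op}$ on related data and under the interpretations of both sides of each equation of $\mathcal E$, in the free interpretation, at related arguments. A formula in context $\Gamma$ denotes a relation on $[\![\Gamma]\!]$: $\eta\,[\![v_1\equiv_A v_2]\!]\,\eta'$ iff $[\![v_1]\!]\eta\sim_A[\![v_2]\!]\eta'$, similarly for computations; $\eta\,[\![\top]\!]\,\eta'$ iff $\eta\sim_\Gamma\eta'$; $\bot,\wedge,\vee,\Rightarrow$ are pointwise; and $\forall x{:}A$, $\exists x{:}A$ range over pairs $a\sim_A a'$. Theorem. (1) The logic $\mathcal L_{\mathrm{pred}}$ is sound: if $\Gamma\vdash h:\Sigma\rightharpoonup\underline D$ respects $\mathcal E$, then for every equation $(x_i{:}A_i)_i;(z_j{:}B_j\to *)_j\vdash T_1\sim T_2$ in $\mathcal E$, all $\eta\sim_\Gamma\eta'$, all $a_i\sim_{A_i}a_i'$ and all $f_j\sim_{B_j\to\underline D}f_j'$, $$[\![T_1]\!]_{[\![h]\!]\eta}((a_i)_i;(f_j)_j)\ \sim_{\underline D}\ [\![T_2]\!]_{[\![h]\!]\eta'}((a_i')_i;(f_j')_j).$$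 (2) If $\Gamma\mid\psi_1,\dots,\psi_n\vdash\varphi$ is derivable, then for all environments $\eta\sim_\Gamma\eta'$ in $[\![\Gamma]\!]$ such that $\eta\,[\![\psi_1\wedge\dots\wedge\psi_n]\!]\,\eta'$, we have $\eta\,[\![\varphi]\!]\,\eta'$. -/

import Mathlib

namespace LPred

/-! ## Terms

Variables are de Bruijn indices: index `0` is the most recently bound variable. -/

/-- Operation names. -/
abbrev OpName := ℕ

mutual
/-- Values `v`. A handler consists of a return clause `cr` (binding one variable) and a finite set
of operation clauses, given by distinct names and bodies; the body of a clause `op(x; k) ↦ c` binds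
`x` (index `1`) and `k` (index `0`). -/
inductive Val : Type
  | var (i : ℕ)
  | unit
  | tt
  | ff
  | lam (c : Comp)
  | mkHandler (cr : Comp) (n : ℕ) (name : Fin n ↪ OpName) (body : Fin n → Comp)

/-- Computations `c`; `op o v c` is the call `o(v; y. c)`, `bind c₁ c₂` is `do x ← c₁ in c₂`,
`handle v c` is `with v handle c`. -/
inductive Comp : Type
  | ite (v : Val) (c₁ c₂ : Comp)
  | app (v₁ v₂ : Val)
  | ret (v : Val)
  | op (o : OpName) (v : Val) (c : Comp)
  | bind (c₁ c₂ : Comp)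
  | handle (v : Val) (c : Comp)
end

/-- Operation clauses `h`: finitely many distinct operation names, each with one body. -/
structure Clauses where
  n : ℕ
  name : Fin n ↪ OpName
  body : Fin n → Comp

/-- The handler with return clause `cr` and operation clauses `h`. -/
abbrev Val.handler (cr : Comp) (h : Clauses) : Val := .mkHandler cr h.n h.name h.body

/-- Lift a renaming under one binder. -/
def liftRen (ρ : ℕ → ℕ) : ℕ → ℕ
  | 0 => 0
  | i + 1 => ρ i + 1

mutual
def Val.rename : Val → (ℕ → ℕ) → Val
  | .var i, ρ => .var (ρ i)
  | .unit, _ => .unit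
  | .tt, _ => .tt
  | .ff, _ => .ff
  | .lam c, ρ => .lam (c.rename (liftRen ρ))
  | .mkHandler cr n name body, ρ =>
      .mkHandler (cr.rename (liftRen ρ)) n name
        (fun i => (body i).rename (liftRen (liftRen ρ)))

def Comp.rename : Comp → (ℕ → ℕ) → Comp
  | .ite v c₁ c₂, ρ => .ite (v.rename ρ) (c₁.rename ρ) (c₂.rename ρ)
  | .app v₁ v₂, ρ => .app (v₁.rename ρ) (v₂.rename ρ)
  | .ret v, ρ => .ret (v.rename ρ)
  | .op o v c, ρ => .op o (v.rename ρ) (c.rename (liftRen ρ))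
  | .bind c₁ c₂, ρ => .bind (c₁.rename ρ) (c₂.rename (liftRen ρ))
  | .handle v c, ρ => .handle (v.rename ρ) (c.rename ρ)
end

/-- Lift a substitution under one binder. -/
def liftSub (σ : ℕ → Val) : ℕ → Val
  | 0 => .var 0
  | i + 1 => (σ i).rename (· + 1)

mutual
/-- Capture-avoiding simultaneous substitution. -/
def Val.subst : Val → (ℕ → Val) → Val
  | .var i, σ => σ i
  | .unit, _ => .unit
  | .tt, _ => .tt
  | .ff, _ => .ff
  | .lam c, σ => .lam (c.subst (liftSub σ))
  | .mkHandler cr n name body, σ =>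
      .mkHandler (cr.subst (liftSub σ)) n name
        (fun i => (body i).subst (liftSub (liftSub σ)))

def Comp.subst : Comp → (ℕ → Val) → Comp
  | .ite v c₁ c₂, σ => .ite (v.subst σ) (c₁.subst σ) (c₂.subst σ)
  | .app v₁ v₂, σ => .app (v₁.subst σ) (v₂.subst σ)
  | .ret v, σ => .ret (v.subst σ)
  | .op o v c, σ => .op o (v.subst σ) (c.subst (liftSub σ))
  | .bind c₁ c₂, σ => .bind (c₁.subst σ) (c₂.subst (liftSub σ))
  | .handle v c, σ => .handle (v.subst σ) (c.subst σ)
end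

def Clauses.rename (h : Clauses) (ρ : ℕ → ℕ) : Clauses :=
  ⟨h.n, h.name, fun i => (h.body i).rename (liftRen (liftRen ρ))⟩

/-- `[v / x]` for the last variable `x`. -/
def sub1 (v : Val) : ℕ → Val
  | 0 => v
  | i + 1 => .var i

/-- `[v / x, w / k]` for the last two variables `x, k` (`k` is the last one). -/
def sub2 (v w : Val) : ℕ → Val
  | 0 => w
  | 1 => v
  | i + 2 => .var i

/-- Simultaneous substitution of `v 0, …, v (n - 1)` for the last `n` variables. -/
def subBlock (n : ℕ) (v : ℕ → Val) (i : ℕ) : Val :=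
  if i < n then v i else .var (i - n)

/-! ## Templates -/

/-- Templates `T`; template variables `z` are numbered from `0`, and ordinary variables are
de Bruijn indices. -/
inductive Tmpl : Type
  | app (z : ℕ) (v : Val)
  | ite (v : Val) (T₁ T₂ : Tmpl)
  | op (o : OpName) (v : Val) (T : Tmpl)

def Tmpl.rename : Tmpl → (ℕ → ℕ) → Tmpl
  | .app z v, ρ => .app z (v.rename ρ)
  | .ite v T₁ T₂, ρ => .ite (v.rename ρ) (T₁.rename ρ) (T₂.rename ρ)
  | .op o v T, ρ => .op o (v.rename ρ) (T.rename (liftRen ρ))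

/-- The computation `T[f_j / z_j]_j`. -/
def Tmpl.inst : Tmpl → (ℕ → Val) → Comp
  | .app z v, f => .app (f z) v
  | .ite v T₁ T₂, f => .ite v (T₁.inst f) (T₂.inst f)
  | .op o v T, f => .op o v (T.inst (fun z => (f z).rename (· + 1)))

open Classical in
/-- The computation `T^h[f_j / z_j]_j`, in which every operation call is handled by its clause
in `h`. Calls of operations without a clause, which do not occur in well-typed instances, are
left in place. -/
noncomputable def Tmpl.handleWith : Tmpl → Clauses → (ℕ → Val) → Comp
  | .app z v, _, f => .app (f z) v
  | .ite v T₁ T₂, h, f => .ite v (T₁.handleWith h f) (T₂.handleWith h f)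
  | .op o v T, h, f =>
      let c := T.handleWith (h.rename (· + 1)) (fun z => (f z).rename (· + 1))
      if ho : ∃ i, h.name i = o then (h.body ho.choose).subst (sub2 v (.lam c)) else .op o v c

/-! ## Types

A signature is a finite family of operations with distinct names, and an effect theory is a finite
family of equations, each consisting of a value context, a template context (the family of argument
types of the template variables) and two templates. Both are finite sets in the mathematics; the
rules below use them only through membership. In the mutual definition the signature and the theory
of a computation type are spread over the arguments of the constructor; `cty` bundles them. -/

mutual
/-- Value types `A, B`. -/
inductive VTy : Type
  | unit
  | bool
  | fn (A : VTy) (C : CTy)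
  | handler (C D : CTy)

/-- Computation types `A ! Σ / E`. -/
inductive CTy : Type
  | mk (A : VTy)
      (n : ℕ) (name : Fin n ↪ OpName) (par res : Fin n → VTy)
      (m : ℕ) (vars : Fin m → Ctx) (k : Fin m → ℕ) (tvars : (e : Fin m) → Fin (k e) → VTy)
      (lhs rhs : Fin m → Tmpl)

/-- Value contexts `Γ`. -/
inductive Ctx : Type
  | nil
  | cons (Γ : Ctx) (A : VTy)
end

/-- Signatures `Σ`: operation `name i` has type `par i → res i`. -/
structure Sig where
  n : ℕ
  name : Fin n ↪ OpName
  par : Fin n → VTy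
  res : Fin n → VTy

/-- Equations `Γ; (z_j : tvars j → *)_j ⊢ lhs ∼ rhs`. -/
structure Equation where
  vars : Ctx
  k : ℕ
  tvars : Fin k → VTy
  lhs : Tmpl
  rhs : Tmpl

/-- Effect theories `E`. -/
structure Theory where
  m : ℕ
  eqn : Fin m → Equation

instance : Membership Equation Theory := ⟨fun E e => ∃ i, E.eqn i = e⟩

/-- The computation type `A ! S / E`. -/
abbrev cty (A : VTy) (S : Sig) (E : Theory) : CTy :=
  .mk A S.n S.name S.par S.res E.m (fun e => (E.eqn e).vars) (fun e => (E.eqn e).k)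
    (fun e => (E.eqn e).tvars) (fun e => (E.eqn e).lhs) (fun e => (E.eqn e).rhs)

def Ctx.length : Ctx → ℕ
  | .nil => 0
  | .cons Γ _ => Γ.length + 1

/-- The type of the variable with the given de Bruijn index. -/
def Ctx.get? : Ctx → ℕ → Option VTy
  | .nil, _ => none
  | .cons _ A, 0 => some A
  | .cons Γ _, i + 1 => Γ.get? i

/-- The context `Γ, Δ`. -/
def Ctx.append (Γ : Ctx) : Ctx → Ctx
  | .nil => Γ
  | .cons Δ A => .cons (Γ.append Δ) A

/-- The context `Γ, (f_j : B j → D)_{j < k}`; the index of `f_j` is `k - 1 - j`. -/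
def Ctx.addFns (Γ : Ctx) (D : CTy) : (k : ℕ) → (Fin k → VTy) → Ctx
  | 0, _ => Γ
  | k + 1, B => .cons (Γ.addFns D k (fun j => B j.castSucc)) (.fn (B (Fin.last k)) D)

/-! ## Set-theoretic semantics of types -/

/-- The elements of `⟦Σ⟧ X`, where operation `i` has parameters in `P i` and results in `R i`. -/
inductive Tree {n : ℕ} (P R : Fin n → Type) (X : Type) : Type
  | ret (x : X)
  | op (i : Fin n) (a : P i) (κ : R i → Tree P R X)

mutual
def VTy.sem : VTy → Type
  | .unit => Unit
  | .bool => Bool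
  | .fn A C => A.sem → C.sem
  | .handler C D => C.sem → D.sem

def CTy.sem : CTy → Type
  | .mk A _ _ par res _ _ _ _ _ _ => Tree (fun i => (par i).sem) (fun i => (res i).sem) A.sem

/-- Environments `⟦Γ⟧`. -/
def Ctx.env : Ctx → Type
  | .nil => Unit
  | .cons Γ A => Γ.env × A.sem
end

/-- `⟦S⟧ X`. -/
abbrev Sig.Free (S : Sig) (X : Type) : Type :=
  Tree (fun i => (S.par i).sem) (fun i => (S.res i).sem) X

/-- Interpretations of the signature `S` over `Y`. -/
abbrev Interp (S : Sig) (Y : Type) : Type :=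
  (i : Fin S.n) → (S.par i).sem → ((S.res i).sem → Y) → Y

/-- The free interpretation. -/
def freeInterp (S : Sig) (X : Type) : Interp S (S.Free X) := fun i a κ => .op i a κ

/-- The lifting of `f : X → Y` along an interpretation `H` over `Y`. -/
def lift {S : Sig} {X Y : Type} (H : Interp S Y) (f : X → Y) : S.Free X → Y
  | .ret x => f x
  | .op i a κ => H i a (fun b => lift H f (κ b))

/-! ## Semantics of terms and templates

`VDen Γ v A d` says that `d` is the denotation of the judgement `Γ ⊢ v : A`, and similarly for
computations, operation clauses and templates. There is one rule for each typing rule, and the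
effect theories play no role. -/

/-- The projection that interprets a variable. -/
inductive Lookup : (Γ : Ctx) → ℕ → (A : VTy) → (Γ.env → A.sem) → Prop
  | zero {Γ : Ctx} {A : VTy} : Lookup (.cons Γ A) 0 A (fun η => η.2)
  | succ {Γ : Ctx} {A B : VTy} {i : ℕ} {p : Γ.env → A.sem} :
      Lookup Γ i A p → Lookup (.cons Γ B) (i + 1) A (fun η => p η.1)

mutual
inductive VDen : (Γ : Ctx) → Val → (A : VTy) → (Γ.env → A.sem) → Prop
  | var {Γ : Ctx} {i : ℕ} {A : VTy} {p : Γ.env → A.sem} :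
      Lookup Γ i A p → VDen Γ (.var i) A p
  | unit {Γ : Ctx} : VDen Γ .unit .unit (fun _ => ())
  | tt {Γ : Ctx} : VDen Γ .tt .bool (fun _ => true)
  | ff {Γ : Ctx} : VDen Γ .ff .bool (fun _ => false)
  | lam {Γ : Ctx} {A : VTy} {C : CTy} {c : Comp} {d : (Γ.cons A).env → C.sem} :
      CDen (Γ.cons A) c C d → VDen Γ (.lam c) (.fn A C) (fun η a => d (η, a))
  | handler {Γ : Ctx} {A : VTy} {S : Sig} {E : Theory} {D : CTy} {cr : Comp} {h : Clauses}
      {d : (Γ.cons A).env → D.sem} {H : Γ.env → Interp S D.sem} :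
      CDen (Γ.cons A) cr D d → HDen Γ h S D H →
      VDen Γ (.handler cr h) (.handler (cty A S E) D)
        (fun η => lift (H η) (fun a => d (η, a)))

inductive CDen : (Γ : Ctx) → Comp → (C : CTy) → (Γ.env → C.sem) → Prop
  | ite {Γ : Ctx} {v : Val} {c₁ c₂ : Comp} {C : CTy}
      {b : Γ.env → Bool} {d₁ d₂ : Γ.env → C.sem} :
      VDen Γ v .bool b → CDen Γ c₁ C d₁ → CDen Γ c₂ C d₂ →
      CDen Γ (.ite v c₁ c₂) C (fun η => bif b η then d₁ η else d₂ η)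
  | app {Γ : Ctx} {v₁ v₂ : Val} {A : VTy} {C : CTy}
      {d₁ : Γ.env → A.sem → C.sem} {d₂ : Γ.env → A.sem} :
      VDen Γ v₁ (.fn A C) d₁ → VDen Γ v₂ A d₂ →
      CDen Γ (.app v₁ v₂) C (fun η => d₁ η (d₂ η))
  | ret {Γ : Ctx} {v : Val} {A : VTy} {S : Sig} {E : Theory} {d : Γ.env → A.sem} :
      VDen Γ v A d → CDen Γ (.ret v) (cty A S E) (fun η => Tree.ret (d η))
  | op {Γ : Ctx} {A : VTy} {S : Sig} {E : Theory} {i : Fin S.n} {v : Val} {c : Comp}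
      {d : Γ.env → (S.par i).sem} {κ : (Γ.cons (S.res i)).env → (cty A S E).sem} :
      VDen Γ v (S.par i) d → CDen (Γ.cons (S.res i)) c (cty A S E) κ →
      CDen Γ (.op (S.name i) v c) (cty A S E) (fun η => Tree.op i (d η) (fun b => κ (η, b)))
  | bind {Γ : Ctx} {A B : VTy} {S : Sig} {E : Theory} {c₁ c₂ : Comp}
      {d₁ : Γ.env → (cty A S E).sem} {d₂ : (Γ.cons A).env → (cty B S E).sem} :
      CDen Γ c₁ (cty A S E) d₁ → CDen (Γ.cons A) c₂ (cty B S E) d₂ →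
      CDen Γ (.bind c₁ c₂) (cty B S E)
        (fun η => lift (freeInterp S B.sem) (fun a => d₂ (η, a)) (d₁ η))
  | handle {Γ : Ctx} {C D : CTy} {v : Val} {c : Comp}
      {d : Γ.env → C.sem → D.sem} {t : Γ.env → C.sem} :
      VDen Γ v (.handler C D) d → CDen Γ c C t →
      CDen Γ (.handle v c) D (fun η => d η (t η))

/-- The denotation of well-typed operation clauses `Γ ⊢ h : S ⇀ D`. The bijection `e` matches the
operations of `S` with the clauses of `h`. -/
inductive HDen : (Γ : Ctx) → Clauses → (S : Sig) → (D : CTy) → (Γ.env → Interp S D.sem) → Prop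
  | mk {Γ : Ctx} {h : Clauses} {S : Sig} {D : CTy} (e : Fin S.n ≃ Fin h.n)
      {d : (i : Fin S.n) → ((Γ.cons (S.par i)).cons (.fn (S.res i) D)).env → D.sem} :
      (∀ i, h.name (e i) = S.name i) →
      (∀ i, CDen ((Γ.cons (S.par i)).cons (.fn (S.res i) D)) (h.body (e i)) D (d i)) →
      HDen Γ h S D (fun η i a κ => d i ((η, a), κ))
end

/-- `⟦Z⟧ Y` for the template context `Z = (z_j : Z j → *)_{j < k}`. -/
abbrev TEnv {k : ℕ} (Z : Fin k → VTy) (Y : Type) : Type := (j : Fin k) → (Z j).sem → Y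

/-- `TDen S Z Γ T t` says that `t` is the denotation of the well-typed template `Γ; Z ⊢ T : S`,
a map `⟦T⟧_H : ⟦Γ⟧ × ⟦Z⟧ Y → Y` for all `Y` and all interpretations `H` of `S` over `Y`. -/
inductive TDen (S : Sig) {k : ℕ} (Z : Fin k → VTy) : (Γ : Ctx) → Tmpl →
    ((Y : Type) → Interp S Y → Γ.env → TEnv Z Y → Y) → Prop
  | app {Γ : Ctx} {j : Fin k} {v : Val} {d : Γ.env → (Z j).sem} :
      VDen Γ v (Z j) d → TDen S Z Γ (.app j v) (fun _ _ η ζ => ζ j (d η))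
  | ite {Γ : Ctx} {v : Val} {T₁ T₂ : Tmpl} {b : Γ.env → Bool}
      {t₁ t₂ : (Y : Type) → Interp S Y → Γ.env → TEnv Z Y → Y} :
      VDen Γ v .bool b → TDen S Z Γ T₁ t₁ → TDen S Z Γ T₂ t₂ →
      TDen S Z Γ (.ite v T₁ T₂) (fun Y H η ζ => bif b η then t₁ Y H η ζ else t₂ Y H η ζ)
  | op {Γ : Ctx} {i : Fin S.n} {v : Val} {T : Tmpl} {d : Γ.env → (S.par i).sem}
      {t : (Y : Type) → Interp S Y → (Γ.cons (S.res i)).env → TEnv Z Y → Y} :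
      VDen Γ v (S.par i) d → TDen S Z (Γ.cons (S.res i)) T t →
      TDen S Z Γ (.op (S.name i) v T)
        (fun Y H η ζ => H i (d η) (fun b => t Y H (η, b) ζ))

/-! ## Semantics of effect theories -/

/-- The smallest symmetric and transitive relation on `⟦S⟧ X` that is closed under returned values,
operation calls and the equations in `E`, given relations `rX` on `X`, `rP` and `rR` on the
parameters and results of operations, and `rΓ` and `rZ` on the contexts of the equations. -/
inductive TreeRel (S : Sig) (E : Theory) {X : Type} (rX : X → X → Prop)
    (rP : (i : Fin S.n) → (S.par i).sem → (S.par i).sem → Prop)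
    (rR : (i : Fin S.n) → (S.res i).sem → (S.res i).sem → Prop)
    (rΓ : (e : Fin E.m) → (E.eqn e).vars.env → (E.eqn e).vars.env → Prop)
    (rZ : (e : Fin E.m) → (j : Fin (E.eqn e).k) →
      ((E.eqn e).tvars j).sem → ((E.eqn e).tvars j).sem → Prop) :
    S.Free X → S.Free X → Prop
  | symm {t t' : S.Free X} :
      TreeRel S E rX rP rR rΓ rZ t t' → TreeRel S E rX rP rR rΓ rZ t' t
  | trans {t t' t'' : S.Free X} :
      TreeRel S E rX rP rR rΓ rZ t t' → TreeRel S E rX rP rR rΓ rZ t' t'' →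
      TreeRel S E rX rP rR rΓ rZ t t''
  | ret {x x' : X} : rX x x' → TreeRel S E rX rP rR rΓ rZ (.ret x) (.ret x')
  | op {i : Fin S.n} {a a' : (S.par i).sem} {f f' : (S.res i).sem → S.Free X} :
      rP i a a' → (∀ b b', rR i b b' → TreeRel S E rX rP rR rΓ rZ (f b) (f' b')) →
      TreeRel S E rX rP rR rΓ rZ (.op i a f) (.op i a' f')
  | eqn {e : Fin E.m}
      {t₁ t₂ : (Y : Type) → Interp S Y → (E.eqn e).vars.env → TEnv (E.eqn e).tvars Y → Y}
      {a a' : (E.eqn e).vars.env} {f f' : TEnv (E.eqn e).tvars (S.Free X)} :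
      TDen S (E.eqn e).tvars (E.eqn e).vars (E.eqn e).lhs t₁ →
      TDen S (E.eqn e).tvars (E.eqn e).vars (E.eqn e).rhs t₂ →
      rΓ e a a' →
      (∀ j b b', rZ e j b b' → TreeRel S E rX rP rR rΓ rZ (f j b) (f' j b')) →
      TreeRel S E rX rP rR rΓ rZ
        (t₁ (S.Free X) (freeInterp S X) a f) (t₂ (S.Free X) (freeInterp S X) a' f')

mutual
/-- The relation `∼_A` on `⟦A⟧`. -/
def VTy.rel : (A : VTy) → A.sem → A.sem → Prop
  | .unit => fun a a' => a = a'
  | .bool => fun a a' => a = a'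
  | .fn A C => fun f f' => ∀ a a', A.rel a a' → C.rel (f a) (f' a')
  | .handler C D => fun f f' => ∀ t t', C.rel t t' → D.rel (f t) (f' t')

/-- The relation `∼_C` on `⟦C⟧`. -/
def CTy.rel : (C : CTy) → C.sem → C.sem → Prop
  | .mk A n name par res m vars k tvars lhs rhs =>
      TreeRel ⟨n, name, par, res⟩ ⟨m, fun e => ⟨vars e, k e, tvars e, lhs e, rhs e⟩⟩
        A.rel (fun i => (par i).rel) (fun i => (res i).rel)
        (fun e => (vars e).rel) (fun e j => (tvars e j).rel)

/-- The relation `∼_Γ` on `⟦Γ⟧`. -/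
def Ctx.rel : (Γ : Ctx) → Γ.env → Γ.env → Prop
  | .nil => fun _ _ => True
  | .cons Γ A => fun η η' => Γ.rel η.1 η'.1 ∧ A.rel η.2 η'.2
end

/-! ## Formulae -/

/-- Formulae; `all A φ` and `ex A φ` bind one variable. -/
inductive Fm : Type
  | veq (v₁ v₂ : Val) (A : VTy)
  | ceq (c₁ c₂ : Comp) (C : CTy)
  | top
  | bot
  | and (φ ψ : Fm)
  | or (φ ψ : Fm)
  | imp (φ ψ : Fm)
  | all (A : VTy) (φ : Fm)
  | ex (A : VTy) (φ : Fm)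

def Fm.rename : Fm → (ℕ → ℕ) → Fm
  | .veq v₁ v₂ A, ρ => .veq (v₁.rename ρ) (v₂.rename ρ) A
  | .ceq c₁ c₂ C, ρ => .ceq (c₁.rename ρ) (c₂.rename ρ) C
  | .top, _ => .top
  | .bot, _ => .bot
  | .and φ ψ, ρ => .and (φ.rename ρ) (ψ.rename ρ)
  | .or φ ψ, ρ => .or (φ.rename ρ) (ψ.rename ρ)
  | .imp φ ψ, ρ => .imp (φ.rename ρ) (ψ.rename ρ)
  | .all A φ, ρ => .all A (φ.rename (liftRen ρ))
  | .ex A φ, ρ => .ex A (φ.rename (liftRen ρ))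

def Fm.subst : Fm → (ℕ → Val) → Fm
  | .veq v₁ v₂ A, σ => .veq (v₁.subst σ) (v₂.subst σ) A
  | .ceq c₁ c₂ C, σ => .ceq (c₁.subst σ) (c₂.subst σ) C
  | .top, _ => .top
  | .bot, _ => .bot
  | .and φ ψ, σ => .and (φ.subst σ) (ψ.subst σ)
  | .or φ ψ, σ => .or (φ.subst σ) (ψ.subst σ)
  | .imp φ ψ, σ => .imp (φ.subst σ) (ψ.subst σ)
  | .all A φ, σ => .all A (φ.subst (liftSub σ))
  | .ex A φ, σ => .ex A (φ.subst (liftSub σ))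

/-- Weakening of a formula by `s` variables. -/
def Fm.shift (s : ℕ) (φ : Fm) : Fm := φ.rename (· + s)

/-- Weakening of hypotheses by `s` variables. -/
def shiftHyps (s : ℕ) (Ψ : List Fm) : List Fm := Ψ.map (Fm.shift s)

/-- A schema `φ(-)` over `Γ` for computations of type `C` is a formula with a further variable
`z : unit → C`, whose uses `z ()` mark the places of the computation. `φ.at s c` is `φ(c)` for a
computation `c` in an extension of `Γ` by `s` variables: the thunk `fun _ ↦ c` is substituted
for `z`. -/
def Fm.at (φ : Fm) (s : ℕ) (c : Comp) : Fm :=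
  φ.subst fun
    | 0 => .lam (c.rename (· + 1))
    | i + 1 => .var (i + s)

/-- The relation `η ⟦φ⟧ η'` on `⟦Γ⟧`. -/
def Fm.holds : (φ : Fm) → (Γ : Ctx) → Γ.env → Γ.env → Prop
  | .veq v₁ v₂ A, Γ, η, η' =>
      ∃ d₁ d₂, VDen Γ v₁ A d₁ ∧ VDen Γ v₂ A d₂ ∧ A.rel (d₁ η) (d₂ η')
  | .ceq c₁ c₂ C, Γ, η, η' =>
      ∃ d₁ d₂, CDen Γ c₁ C d₁ ∧ CDen Γ c₂ C d₂ ∧ C.rel (d₁ η) (d₂ η')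
  | .top, Γ, η, η' => Γ.rel η η'
  | .bot, _, _, _ => False
  | .and φ ψ, Γ, η, η' => φ.holds Γ η η' ∧ ψ.holds Γ η η'
  | .or φ ψ, Γ, η, η' => φ.holds Γ η η' ∨ ψ.holds Γ η η'
  | .imp φ ψ, Γ, η, η' => φ.holds Γ η η' → ψ.holds Γ η η'
  | .all A φ, Γ, η, η' => ∀ a a', A.rel a a' → φ.holds (Γ.cons A) (η, a) (η', a')
  | .ex A φ, Γ, η, η' => ∃ a a', A.rel a a' ∧ φ.holds (Γ.cons A) (η, a) (η', a')

/-! ## Type system and logic -/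

/-- The judgement forms of the type system and of the predicate logic. -/
inductive Judg : Type
  /-- `⊢ A` -/
  | vty (A : VTy)
  /-- `⊢ C` -/
  | cty (C : CTy)
  /-- `⊢ S` -/
  | sig (S : Sig)
  /-- `⊢ Γ` -/
  | ctx (Γ : Ctx)
  /-- `⊢ Z` -/
  | tctx (k : ℕ) (Z : Fin k → VTy)
  /-- `Γ; Z ⊢ T : S` -/
  | tmpl (Γ : Ctx) (k : ℕ) (Z : Fin k → VTy) (T : Tmpl) (S : Sig)
  /-- `⊢ E : S` -/
  | theory (E : Theory) (S : Sig)
  /-- `Γ ⊢ v : A` -/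
  | val (Γ : Ctx) (v : Val) (A : VTy)
  /-- `Γ ⊢ c : C` -/
  | comp (Γ : Ctx) (c : Comp) (C : CTy)
  /-- `Γ ⊢ h : S ⇀ D` -/
  | clauses (Γ : Ctx) (h : Clauses) (S : Sig) (D : CTy)
  /-- `Γ ⊢ h : S ⇀ D respects E` -/
  | respects (Γ : Ctx) (h : Clauses) (E : Theory) (S : Sig) (D : CTy)
  /-- `φ` is a well-typed formula in the context `Γ` -/
  | fm (Γ : Ctx) (φ : Fm)
  /-- `Γ` is well-formed and the hypotheses `Ψ` are well-typed formulae in `Γ` -/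
  | hyps (Γ : Ctx) (Ψ : List Fm)
  /-- `Γ | Ψ ⊢ φ` -/
  | entails (Γ : Ctx) (Ψ : List Fm) (φ : Fm)

/-- Derivability of judgements in the logic `L_pred`, a single simultaneous definition of
well-formedness, typing, respecting a theory, and logical entailment. -/
inductive Provable : Judg → Prop
  /- Well-formed types, signatures and contexts -/
  | vty_unit : Provable (.vty .unit)
  | vty_bool : Provable (.vty .bool)
  | vty_fn {A C} : Provable (.vty A) → Provable (.cty C) → Provable (.vty (.fn A C))
  | vty_handler {C D} :
      Provable (.cty C) → Provable (.cty D) → Provable (.vty (.handler C D))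
  | cty_mk {A S E} : Provable (.vty A) → Provable (.sig S) → Provable (.theory E S) →
      Provable (.cty (cty A S E))
  | sig_mk {S : Sig} : (∀ i, Provable (.vty (S.par i))) → (∀ i, Provable (.vty (S.res i))) →
      Provable (.sig S)
  | ctx_nil : Provable (.ctx .nil)
  | ctx_cons {Γ A} : Provable (.ctx Γ) → Provable (.vty A) → Provable (.ctx (.cons Γ A))
  | tctx_mk {k} {Z : Fin k → VTy} : (∀ j, Provable (.vty (Z j))) → Provable (.tctx k Z)
  /- Well-typed templates and well-formed theories -/
  | tmpl_app {Γ k Z S v} {j : Fin k} :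
      Provable (.tctx k Z) → Provable (.sig S) → Provable (.val Γ v (Z j)) →
      Provable (.tmpl Γ k Z (.app j v) S)
  | tmpl_ite {Γ k Z S v T₁ T₂} : Provable (.val Γ v .bool) →
      Provable (.tmpl Γ k Z T₁ S) → Provable (.tmpl Γ k Z T₂ S) →
      Provable (.tmpl Γ k Z (.ite v T₁ T₂) S)
  | tmpl_op {Γ k Z v T} {S : Sig} {i : Fin S.n} : Provable (.val Γ v (S.par i)) →
      Provable (.tmpl (Γ.cons (S.res i)) k Z T S) →
      Provable (.tmpl Γ k Z (.op (S.name i) v T) S)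
  | theory_mk {E S} : Provable (.sig S) →
      (∀ e : Equation, e ∈ E → Provable (.ctx e.vars)) →
      (∀ e : Equation, e ∈ E → Provable (.tctx e.k e.tvars)) →
      (∀ e : Equation, e ∈ E → Provable (.tmpl e.vars e.k e.tvars e.lhs S)) →
      (∀ e : Equation, e ∈ E → Provable (.tmpl e.vars e.k e.tvars e.rhs S)) →
      Provable (.theory E S)
  /- Well-typed values -/
  | val_var {Γ : Ctx} {i A} : Provable (.ctx Γ) → Γ.get? i = some A → Provable (.val Γ (.var i) A)
  | val_unit {Γ} : Provable (.ctx Γ) → Provable (.val Γ .unit .unit)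
  | val_tt {Γ} : Provable (.ctx Γ) → Provable (.val Γ .tt .bool)
  | val_ff {Γ} : Provable (.ctx Γ) → Provable (.val Γ .ff .bool)
  | val_lam {Γ A C c} : Provable (.comp (Γ.cons A) c C) → Provable (.val Γ (.lam c) (.fn A C))
  | val_handler {Γ A S E D cr h} :
      Provable (.comp (Γ.cons A) cr D) → Provable (.respects Γ h E S D) →
      Provable (.val Γ (.handler cr h) (.handler (cty A S E) D))
  /- Well-typed computations -/
  | comp_ite {Γ v c₁ c₂ C} :
      Provable (.val Γ v .bool) → Provable (.comp Γ c₁ C) → Provable (.comp Γ c₂ C) →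
      Provable (.comp Γ (.ite v c₁ c₂) C)
  | comp_app {Γ v₁ v₂ A C} : Provable (.val Γ v₁ (.fn A C)) → Provable (.val Γ v₂ A) →
      Provable (.comp Γ (.app v₁ v₂) C)
  | comp_ret {Γ v A S E} : Provable (.val Γ v A) → Provable (.cty (cty A S E)) →
      Provable (.comp Γ (.ret v) (cty A S E))
  | comp_op {Γ v c A E} {S : Sig} {i : Fin S.n} : Provable (.val Γ v (S.par i)) →
      Provable (.comp (Γ.cons (S.res i)) c (cty A S E)) →
      Provable (.comp Γ (.op (S.name i) v c) (cty A S E))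
  | comp_bind {Γ c₁ c₂ A B S E} : Provable (.comp Γ c₁ (cty A S E)) →
      Provable (.comp (Γ.cons A) c₂ (cty B S E)) →
      Provable (.comp Γ (.bind c₁ c₂) (cty B S E))
  | comp_handle {Γ v c C D} : Provable (.val Γ v (.handler C D)) → Provable (.comp Γ c C) →
      Provable (.comp Γ (.handle v c) D)
  /- Well-typed operation clauses: `h` has a clause for exactly the operations of `S` -/
  | clauses_mk {Γ D} {h : Clauses} {S : Sig} (e : Fin S.n ≃ Fin h.n) :
      Provable (.ctx Γ) → Provable (.sig S) → Provable (.cty D) →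
      (∀ i, h.name (e i) = S.name i) →
      (∀ i, Provable (.comp ((Γ.cons (S.par i)).cons (.fn (S.res i) D)) (h.body (e i)) D)) →
      Provable (.clauses Γ h S D)
  /- Operation clauses that respect a theory: the empty theory, and a theory `E' = E ∪ {e}` -/
  | respects_empty {Γ h S D} {E : Theory} : Provable (.clauses Γ h S D) →
      Provable (.theory E S) → (∀ e : Equation, e ∉ E) → Provable (.respects Γ h E S D)
  | respects_insert {Γ S D} {h : Clauses} {E E' : Theory} {e : Equation} :
      Provable (.respects Γ h E S D) → Provable (.theory E' S) →
      (∀ e' : Equation, e' ∈ E' ↔ e' ∈ E ∨ e' = e) →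
      Provable (.entails ((Γ.append e.vars).addFns D e.k e.tvars) []
        (.ceq
          ((e.lhs.rename (· + e.k)).handleWith (h.rename (· + (e.vars.length + e.k)))
            (fun j => .var (e.k - 1 - j)))
          ((e.rhs.rename (· + e.k)).handleWith (h.rename (· + (e.vars.length + e.k)))
            (fun j => .var (e.k - 1 - j)))
          D)) →
      Provable (.respects Γ h E' S D)
  /- Well-typed formulae and hypotheses -/
  | fm_veq {Γ v₁ v₂ A} : Provable (.val Γ v₁ A) → Provable (.val Γ v₂ A) →
      Provable (.fm Γ (.veq v₁ v₂ A))
  | fm_ceq {Γ c₁ c₂ C} : Provable (.comp Γ c₁ C) → Provable (.comp Γ c₂ C) →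
      Provable (.fm Γ (.ceq c₁ c₂ C))
  | fm_top {Γ} : Provable (.ctx Γ) → Provable (.fm Γ .top)
  | fm_bot {Γ} : Provable (.ctx Γ) → Provable (.fm Γ .bot)
  | fm_and {Γ φ ψ} : Provable (.fm Γ φ) → Provable (.fm Γ ψ) → Provable (.fm Γ (.and φ ψ))
  | fm_or {Γ φ ψ} : Provable (.fm Γ φ) → Provable (.fm Γ ψ) → Provable (.fm Γ (.or φ ψ))
  | fm_imp {Γ φ ψ} : Provable (.fm Γ φ) → Provable (.fm Γ ψ) → Provable (.fm Γ (.imp φ ψ))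
  | fm_all {Γ A φ} : Provable (.fm (Γ.cons A) φ) → Provable (.fm Γ (.all A φ))
  | fm_ex {Γ A φ} : Provable (.fm (Γ.cons A) φ) → Provable (.fm Γ (.ex A φ))
  | hyps_mk {Γ} {Ψ : List Fm} : Provable (.ctx Γ) → (∀ ψ ∈ Ψ, Provable (.fm Γ ψ)) →
      Provable (.hyps Γ Ψ)
  /- Structural rules and substitution -/
  | hyp {Γ φ} {Ψ : List Fm} : Provable (.hyps Γ Ψ) → φ ∈ Ψ → Provable (.entails Γ Ψ φ)
  | weaken {Γ φ} {Ψ Ψ' : List Fm} : Provable (.entails Γ Ψ φ) → (∀ ψ ∈ Ψ, ψ ∈ Ψ') →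
      Provable (.hyps Γ Ψ') → Provable (.entails Γ Ψ' φ)
  | subst {Γ Γ' : Ctx} {Ψ φ} {σ : ℕ → Val} : Provable (.hyps Γ Ψ) → Provable (.fm Γ φ) →
      Provable (.ctx Γ') → (∀ i A, Γ.get? i = some A → Provable (.val Γ' (σ i) A)) →
      Provable (.entails Γ Ψ φ) →
      Provable (.entails Γ' (Ψ.map fun ψ => ψ.subst σ) (φ.subst σ))
  | replace {Γ Ψ A φ v w} : Provable (.fm (Γ.cons A) φ) →
      Provable (.val Γ v A) → Provable (.val Γ w A) → Provable (.entails Γ Ψ (.veq v w A)) →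
      Provable (.entails Γ Ψ (φ.subst (sub1 v))) → Provable (.entails Γ Ψ (φ.subst (sub1 w)))
  /- Equivalence -/
  | veq_refl {Γ Ψ v A} : Provable (.hyps Γ Ψ) → Provable (.val Γ v A) →
      Provable (.entails Γ Ψ (.veq v v A))
  | veq_symm {Γ Ψ v w A} : Provable (.entails Γ Ψ (.veq v w A)) →
      Provable (.entails Γ Ψ (.veq w v A))
  | veq_trans {Γ Ψ u v w A} : Provable (.entails Γ Ψ (.veq u v A)) →
      Provable (.entails Γ Ψ (.veq v w A)) → Provable (.entails Γ Ψ (.veq u w A))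
  | ceq_refl {Γ Ψ c C} : Provable (.hyps Γ Ψ) → Provable (.comp Γ c C) →
      Provable (.entails Γ Ψ (.ceq c c C))
  | ceq_symm {Γ Ψ c c' C} : Provable (.entails Γ Ψ (.ceq c c' C)) →
      Provable (.entails Γ Ψ (.ceq c' c C))
  | ceq_trans {Γ Ψ c c' c'' C} : Provable (.entails Γ Ψ (.ceq c c' C)) →
      Provable (.entails Γ Ψ (.ceq c' c'' C)) → Provable (.entails Γ Ψ (.ceq c c'' C))
  /- Congruences -/
  | congr_lam {Γ Ψ A C c c'} : Provable (.hyps Γ Ψ) →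
      Provable (.entails (Γ.cons A) (shiftHyps 1 Ψ) (.ceq c c' C)) →
      Provable (.entails Γ Ψ (.veq (.lam c) (.lam c') (.fn A C)))
  | congr_handler {Γ Ψ A S E D cr cr'} {h h' : Clauses} : Provable (.hyps Γ Ψ) →
      Provable (.val Γ (.handler cr h) (.handler (cty A S E) D)) →
      Provable (.val Γ (.handler cr' h') (.handler (cty A S E) D)) →
      Provable (.entails (Γ.cons A) (shiftHyps 1 Ψ) (.ceq cr cr' D)) →
      (∀ i j j', h.name j = S.name i → h'.name j' = S.name i →
        Provable (.entails ((Γ.cons (S.par i)).cons (.fn (S.res i) D)) (shiftHyps 2 Ψ)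
          (.ceq (h.body j) (h'.body j') D))) →
      Provable (.entails Γ Ψ
        (.veq (.handler cr h) (.handler cr' h') (.handler (cty A S E) D)))
  | congr_ite {Γ Ψ v v' c₁ c₁' c₂ c₂' C} : Provable (.entails Γ Ψ (.veq v v' .bool)) →
      Provable (.entails Γ Ψ (.ceq c₁ c₁' C)) → Provable (.entails Γ Ψ (.ceq c₂ c₂' C)) →
      Provable (.entails Γ Ψ (.ceq (.ite v c₁ c₂) (.ite v' c₁' c₂') C))
  | congr_app {Γ Ψ v v' w w' A C} : Provable (.entails Γ Ψ (.veq v v' (.fn A C))) →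
      Provable (.entails Γ Ψ (.veq w w' A)) →
      Provable (.entails Γ Ψ (.ceq (.app v w) (.app v' w') C))
  | congr_ret {Γ Ψ v v' A S E} : Provable (.cty (cty A S E)) →
      Provable (.entails Γ Ψ (.veq v v' A)) →
      Provable (.entails Γ Ψ (.ceq (.ret v) (.ret v') (cty A S E)))
  | congr_op {Γ Ψ v v' c c' A E} {S : Sig} {i : Fin S.n} :
      Provable (.entails Γ Ψ (.veq v v' (S.par i))) →
      Provable (.entails (Γ.cons (S.res i)) (shiftHyps 1 Ψ) (.ceq c c' (cty A S E))) →
      Provable (.entails Γ Ψ (.ceq (.op (S.name i) v c) (.op (S.name i) v' c') (cty A S E)))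
  | congr_bind {Γ Ψ c₁ c₁' c₂ c₂' A B S E} :
      Provable (.entails Γ Ψ (.ceq c₁ c₁' (cty A S E))) →
      Provable (.entails (Γ.cons A) (shiftHyps 1 Ψ) (.ceq c₂ c₂' (cty B S E))) →
      Provable (.entails Γ Ψ (.ceq (.bind c₁ c₂) (.bind c₁' c₂') (cty B S E)))
  | congr_handle {Γ Ψ v v' c c' C D} : Provable (.entails Γ Ψ (.veq v v' (.handler C D))) →
      Provable (.entails Γ Ψ (.ceq c c' C)) →
      Provable (.entails Γ Ψ (.ceq (.handle v c) (.handle v' c') D))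
  /- Computation rules -/
  | beta_tt {Γ Ψ c₁ c₂ C} : Provable (.hyps Γ Ψ) → Provable (.comp Γ c₁ C) →
      Provable (.comp Γ c₂ C) → Provable (.entails Γ Ψ (.ceq (.ite .tt c₁ c₂) c₁ C))
  | beta_ff {Γ Ψ c₁ c₂ C} : Provable (.hyps Γ Ψ) → Provable (.comp Γ c₁ C) →
      Provable (.comp Γ c₂ C) → Provable (.entails Γ Ψ (.ceq (.ite .ff c₁ c₂) c₂ C))
  | beta_app {Γ Ψ A C c v} : Provable (.hyps Γ Ψ) → Provable (.comp (Γ.cons A) c C) →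
      Provable (.val Γ v A) →
      Provable (.entails Γ Ψ (.ceq (.app (.lam c) v) (c.subst (sub1 v)) C))
  | beta_bind_ret {Γ Ψ A B S E v c} : Provable (.hyps Γ Ψ) → Provable (.val Γ v A) →
      Provable (.comp (Γ.cons A) c (cty B S E)) →
      Provable (.entails Γ Ψ (.ceq (.bind (.ret v) c) (c.subst (sub1 v)) (cty B S E)))
  | beta_bind_op {Γ Ψ A B E v c₁ c₂} {S : Sig} {i : Fin S.n} : Provable (.hyps Γ Ψ) →
      Provable (.val Γ v (S.par i)) → Provable (.comp (Γ.cons (S.res i)) c₁ (cty A S E)) →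
      Provable (.comp (Γ.cons A) c₂ (cty B S E)) →
      Provable (.entails Γ Ψ
        (.ceq (.bind (.op (S.name i) v c₁) c₂)
          (.op (S.name i) v (.bind c₁ (c₂.rename (liftRen (· + 1))))) (cty B S E)))
  | beta_handle_ret {Γ Ψ A S E D cr h v} : Provable (.hyps Γ Ψ) →
      Provable (.val Γ (.handler cr h) (.handler (cty A S E) D)) → Provable (.val Γ v A) →
      Provable (.entails Γ Ψ
        (.ceq (.handle (.handler cr h) (.ret v)) (cr.subst (sub1 v)) D))
  | beta_handle_op {Γ Ψ A E D cr v c} {S : Sig} {h : Clauses} {i : Fin S.n} {j : Fin h.n} :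
      Provable (.hyps Γ Ψ) → Provable (.val Γ (.handler cr h) (.handler (cty A S E) D)) →
      Provable (.val Γ v (S.par i)) → Provable (.comp (Γ.cons (S.res i)) c (cty A S E)) →
      h.name j = S.name i →
      Provable (.entails Γ Ψ
        (.ceq (.handle (.handler cr h) (.op (S.name i) v c))
          ((h.body j).subst
            (sub2 v (.lam (.handle ((Val.handler cr h).rename (· + 1)) c)))) D))
  /- Extensionality rules -/
  | eta_unit {Γ Ψ v} : Provable (.hyps Γ Ψ) → Provable (.val Γ v .unit) →
      Provable (.entails Γ Ψ (.veq v .unit .unit))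
  | eta_bool {Γ Ψ v c C} : Provable (.hyps Γ Ψ) → Provable (.val Γ v .bool) →
      Provable (.comp (Γ.cons .bool) c C) →
      Provable (.entails Γ Ψ
        (.ceq (c.subst (sub1 v)) (.ite v (c.subst (sub1 .tt)) (c.subst (sub1 .ff))) C))
  | eta_fn {Γ Ψ v A C} : Provable (.hyps Γ Ψ) → Provable (.val Γ v (.fn A C)) →
      Provable (.entails Γ Ψ (.veq v (.lam (.app (v.rename (· + 1)) (.var 0))) (.fn A C)))
  | eta_bind {Γ Ψ c A S E} : Provable (.hyps Γ Ψ) → Provable (.comp Γ c (cty A S E)) →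
      Provable (.entails Γ Ψ (.ceq (.bind c (.ret (.var 0))) c (cty A S E)))
  /- Inheriting equations from the effect theory -/
  | inherit {Γ Ψ A S} {E : Theory} {e : Equation} {v f : ℕ → Val} : Provable (.hyps Γ Ψ) →
      Provable (.cty (cty A S E)) → e ∈ E →
      (∀ i B, e.vars.get? i = some B → Provable (.val Γ (v i) B)) →
      (∀ j : Fin e.k, Provable (.val Γ (f j) (.fn (e.tvars j) (cty A S E)))) →
      Provable (.entails Γ Ψ
        (.ceq
          ((e.lhs.inst fun j => (f j).rename (· + e.vars.length)).subst
            (subBlock e.vars.length v))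
          ((e.rhs.inst fun j => (f j).rename (· + e.vars.length)).subst
            (subBlock e.vars.length v))
          (cty A S E)))
  /- Logical connectives and quantifiers -/
  | top_intro {Γ Ψ} : Provable (.hyps Γ Ψ) → Provable (.entails Γ Ψ .top)
  | bot_elim {Γ Ψ φ} : Provable (.fm Γ φ) → Provable (.entails Γ Ψ .bot) →
      Provable (.entails Γ Ψ φ)
  | and_intro {Γ Ψ φ ψ} : Provable (.entails Γ Ψ φ) → Provable (.entails Γ Ψ ψ) →
      Provable (.entails Γ Ψ (.and φ ψ))
  | and_left {Γ Ψ φ ψ} : Provable (.entails Γ Ψ (.and φ ψ)) → Provable (.entails Γ Ψ φ)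
  | and_right {Γ Ψ φ ψ} : Provable (.entails Γ Ψ (.and φ ψ)) → Provable (.entails Γ Ψ ψ)
  | or_left {Γ Ψ φ ψ} : Provable (.fm Γ ψ) → Provable (.entails Γ Ψ φ) →
      Provable (.entails Γ Ψ (.or φ ψ))
  | or_right {Γ Ψ φ ψ} : Provable (.fm Γ φ) → Provable (.entails Γ Ψ ψ) →
      Provable (.entails Γ Ψ (.or φ ψ))
  | or_elim {Γ Ψ φ ψ χ} : Provable (.entails Γ Ψ (.or φ ψ)) →
      Provable (.entails Γ (φ :: Ψ) χ) → Provable (.entails Γ (ψ :: Ψ) χ) →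
      Provable (.entails Γ Ψ χ)
  | imp_intro {Γ Ψ φ ψ} : Provable (.hyps Γ Ψ) → Provable (.fm Γ φ) →
      Provable (.entails Γ (φ :: Ψ) ψ) → Provable (.entails Γ Ψ (.imp φ ψ))
  | imp_elim {Γ Ψ φ ψ} : Provable (.entails Γ Ψ (.imp φ ψ)) → Provable (.entails Γ Ψ φ) →
      Provable (.entails Γ Ψ ψ)
  | all_intro {Γ Ψ A φ} : Provable (.hyps Γ Ψ) →
      Provable (.entails (Γ.cons A) (shiftHyps 1 Ψ) φ) → Provable (.entails Γ Ψ (.all A φ))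
  | all_elim {Γ Ψ A φ v} : Provable (.fm (Γ.cons A) φ) → Provable (.val Γ v A) →
      Provable (.entails Γ Ψ (.all A φ)) → Provable (.entails Γ Ψ (φ.subst (sub1 v)))
  | ex_intro {Γ Ψ A φ v} : Provable (.fm (Γ.cons A) φ) → Provable (.val Γ v A) →
      Provable (.entails Γ Ψ (φ.subst (sub1 v))) → Provable (.entails Γ Ψ (.ex A φ))
  | ex_elim {Γ Ψ A φ χ} : Provable (.fm Γ χ) → Provable (.entails Γ Ψ (.ex A φ)) →
      Provable (.entails (Γ.cons A) (φ :: shiftHyps 1 Ψ) (χ.shift 1)) →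
      Provable (.entails Γ Ψ χ)
  | em {Γ Ψ φ} : Provable (.hyps Γ Ψ) → Provable (.fm Γ φ) →
      Provable (.entails Γ Ψ (.or φ (.imp φ .bot)))
  /- Induction on the computation `c` -/
  | induction {Γ Ψ A E c φ} {S : Sig} : Provable (.hyps Γ Ψ) →
      Provable (.comp Γ c (cty A S E)) →
      Provable (.fm (Γ.cons (.fn .unit (cty A S E))) φ) →
      Provable (.entails (Γ.cons A) (shiftHyps 1 Ψ) (φ.at 1 (.ret (.var 0)))) →
      (∀ i : Fin S.n,
        Provable (.entails ((Γ.cons (S.par i)).cons (.fn (S.res i) (cty A S E)))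
          (.all (S.res i) (φ.at 3 (.app (.var 1) (.var 0))) :: shiftHyps 2 Ψ)
          (φ.at 2 (.op (S.name i) (.var 1) (.app (.var 1) (.var 0)))))) →
      Provable (.entails Γ Ψ (φ.at 0 c))

/-! ## Soundness of a logic -/

/-- A logic, given by its judgement `R Γ h E S D` that the clauses `Γ ⊢ h : S ⇀ D` respect `E`, is
sound if the denotation of the clauses maps the two sides of every equation in `E` to related
elements of `⟦D⟧`. -/
def SoundLogic (R : Ctx → Clauses → Theory → Sig → CTy → Prop) : Prop :=
  ∀ (Γ : Ctx) (h : Clauses) (E : Theory) (S : Sig) (D : CTy), R Γ h E S D →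
    ∀ e : Equation, e ∈ E → ∃ H t₁ t₂,
      HDen Γ h S D H ∧ TDen S e.tvars e.vars e.lhs t₁ ∧ TDen S e.tvars e.vars e.rhs t₂ ∧
      ∀ η η', Γ.rel η η' → ∀ a a', e.vars.rel a a' →
        ∀ f f' : TEnv e.tvars D.sem, (∀ j, (VTy.fn (e.tvars j) D).rel (f j) (f' j)) →
          D.rel (t₁ D.sem (H η) a f) (t₂ D.sem (H η') a' f')

end LPred

-- Typing, respecting a theory and logical entailment are derived simultaneously, so soundness is
-- one induction over all derivations, `Provable.sem`. Each judgement receives a semantic reading. A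
-- well-typed term has a denotation that carries related environments to related results. An
-- entailment is valid at every related pair of environments. Respecting clauses denote an
-- interpretation that preserves the relations and identifies the two sides of each equation. Both
-- parts of the theorem are read off from the last two readings.
--
-- Three ideas carry the induction.
--
-- Coherence. Terms carry no type annotations, so two derivations of one judgement may pass through
-- different intermediate types. A logical relation `het` between the meanings of different types,
-- matching operations by name, relates any two denotations of one term. At a single type it is
-- equality (`VTy.het_self`), so denotations are unique (`VDen.unique`, `CDen.unique`). Only then
-- can one compute with "the" denotation of a term occurring in several premises.
--
-- Handling respects theories. Every template denotation commutes with `lift` (`TDen.lift`). Lifting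
-- along an interpretation that respects `E` therefore turns the generating equations of `∼` into
-- instances of the respect condition, and induction on the derivation of `t ∼ t'` shows that
-- handling preserves `∼` (`lift_rel`). Sequencing is the case of the free interpretation.
-- Conversely, `TDen.handleWith` identifies the meaning of `T^h` with that of `T` in the
-- interpretation given by `h`, so a derivable equation between handled templates yields the respect
-- condition (`RespectsOk.insert`).
--
-- Invariance and parametricity. Formulae do not distinguish related environments
-- (`Fm.holds_congr`), and templates preserve every relation that the interpretations preserve
-- (`TOk`). In the induction principle the hypotheses make the predicate closed under returns and
-- operations. Parametricity extends this to one side of an equation, and invariance moves it to the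
-- other side. The congruence rule for handlers uses parametricity in the same way.

namespace LPred

/-! ## Coherence -/

/-- A relation between trees over different signatures, matching operations by `N`. -/
inductive TreeHet {n n' : ℕ} {P R : Fin n → Type} {P' R' : Fin n' → Type} {X X' : Type}
    (N : Fin n → Fin n' → Prop) (rX : X → X' → Prop)
    (rP : ∀ i i', P i → P' i' → Prop) (rR : ∀ i i', R i → R' i' → Prop) :
    Tree P R X → Tree P' R' X' → Prop
  | ret {x x'} : rX x x' → TreeHet N rX rP rR (.ret x) (.ret x')
  | op {i i' a a' κ κ'} : N i i' → rP i i' a a' →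
      (∀ b b', rR i i' b b' → TreeHet N rX rP rR (κ b) (κ' b')) →
      TreeHet N rX rP rR (.op i a κ) (.op i' a' κ')

mutual
/-- The logical relation between the denotations of two value types. -/
def VTy.het : (A B : VTy) → A.sem → B.sem → Prop
  | .unit, B => match B with
    | .unit => fun _ _ => True
    | .bool => fun _ _ => False
    | .fn _ _ => fun _ _ => False
    | .handler _ _ => fun _ _ => False
  | .bool, B => match B with
    | .bool => fun b b' => b = b'
    | .unit => fun _ _ => False
    | .fn _ _ => fun _ _ => False
    | .handler _ _ => fun _ _ => False
  | .fn A C, B => match B with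
    | .fn A' C' => fun f f' => ∀ a a', A.het A' a a' → C.het C' (f a) (f' a')
    | .bool => fun _ _ => False
    | .unit => fun _ _ => False
    | .handler _ _ => fun _ _ => False
  | .handler C D, B => match B with
    | .handler C' D' => fun f f' => ∀ t t', C.het C' t t' → D.het D' (f t) (f' t')
    | .bool => fun _ _ => False
    | .unit => fun _ _ => False
    | .fn _ _ => fun _ _ => False

/-- The logical relation between the denotations of two computation types. -/
def CTy.het : (C D : CTy) → C.sem → D.sem → Prop
  | .mk A _ name par res _ _ _ _ _ _, D => match D with
    | .mk A' _ name' par' res' _ _ _ _ _ _ =>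
      TreeHet (fun i i' => name i = name' i') (A.het A')
        (fun i i' => (par i).het (par' i')) (fun i i' => (res i).het (res' i'))
end

/-- The logical relation between environments of two contexts. -/
def Ctx.het : (Γ Δ : Ctx) → Γ.env → Δ.env → Prop
  | .nil, .nil => fun _ _ => True
  | .nil, .cons _ _ => fun _ _ => False
  | .cons _ _, .nil => fun _ _ => False
  | .cons Γ A, .cons Δ B => fun η η' => Γ.het Δ η.1 η'.1 ∧ A.het B η.2 η'.2

-- The two directions feed each other: function extensionality applies the hypothesis to a pair `(a,
-- a)`, related by reflexivity at the argument type, while the converse first turns related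
-- arguments into equal ones. In trees, distinctness of operation names turns equal names into equal
-- indices.
mutual
theorem VTy.het_self : (A : VTy) → ∀ a a' : A.sem, A.het A a a' ↔ a = a'
  | .unit => fun _ _ => ⟨fun _ => rfl, fun _ => trivial⟩
  | .bool => fun _ _ => Iff.rfl
  | .fn A C => fun f f' => by
      constructor
      · intro h
        funext a
        exact (C.het_self _ _).1 (h a a ((A.het_self _ _).2 rfl))
      · rintro rfl a a' h
        obtain rfl := (A.het_self _ _).1 h
        exact (C.het_self _ _).2 rfl
  | .handler C D => fun f f' => by
      constructor
      · intro h
        funext a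
        exact (D.het_self _ _).1 (h a a ((C.het_self _ _).2 rfl))
      · rintro rfl a a' h
        obtain rfl := (C.het_self _ _).1 h
        exact (D.het_self _ _).2 rfl

theorem CTy.het_self : (C : CTy) → ∀ t t' : C.sem, C.het C t t' ↔ t = t'
  | .mk A n name par res m vars k tvars lhs rhs => fun t t' => by
      constructor
      · intro h
        change TreeHet _ _ _ _ t t' at h
        induction h with
        | ret h => exact congrArg Tree.ret ((A.het_self _ _).1 h)
        | @op i i' a a' κ κ' hN hP _ ih =>
          obtain rfl := name.injective hN
          obtain rfl := ((par i).het_self _ _).1 hP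
          exact congrArg (Tree.op i a)
            (funext fun b => ih b b (((res i).het_self _ _).2 rfl))
      · rintro rfl
        change TreeHet _ _ _ _ t t
        change Tree _ _ _ at t
        induction t with
        | ret x => exact .ret ((A.het_self _ _).2 rfl)
        | op i a κ ih =>
          refine .op rfl (((par i).het_self _ _).2 rfl) fun b b' hb => ?_
          obtain rfl := ((res i).het_self _ _).1 hb
          exact ih b
end

theorem Ctx.het_refl : (Γ : Ctx) → ∀ η : Γ.env, Γ.het Γ η η
  | .nil, _ => trivial
  | .cons Γ A, η => ⟨Γ.het_refl η.1, (A.het_self _ _).2 rfl⟩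

theorem Lookup.het {Γ : Ctx} {i : ℕ} {A : VTy} {p : Γ.env → A.sem} (h : Lookup Γ i A p) :
    ∀ {Γ' A'} {p' : Γ'.env → VTy.sem A'}, Lookup Γ' i A' p' →
      ∀ η η', Γ.het Γ' η η' → A.het A' (p η) (p' η') := by
  induction h with
  | zero =>
    intro Γ' A' p' h' η η' hη
    cases h'
    exact hη.2
  | succ _ ih =>
    intro Γ' A' p' h' η η' hη
    cases h' with
    | succ h' => exact ih h' _ _ hη.1

/-- Covers handling, with the interpretations denoted by clauses, and sequencing, with the free
interpretations. -/
theorem lift_het {A A' : VTy} {S S' : Sig} {E E' : Theory} {D D' : CTy}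
    {H : Interp S D.sem} {H' : Interp S' D'.sem} {g : A.sem → D.sem} {g' : A'.sem → D'.sem}
    (hH : ∀ i i', S.name i = S'.name i' → ∀ a a', (S.par i).het (S'.par i') a a' →
      ∀ κ κ', (∀ b b', (S.res i).het (S'.res i') b b' → D.het D' (κ b) (κ' b')) →
        D.het D' (H i a κ) (H' i' a' κ'))
    (hg : ∀ a a', A.het A' a a' → D.het D' (g a) (g' a')) {t : (cty A S E).sem}
    {t' : (cty A' S' E').sem} (ht : (cty A S E).het (cty A' S' E') t t') :
    D.het D' (lift H g t) (lift H' g' t') := by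
  change TreeHet _ _ _ _ t t' at ht
  induction ht with
  | ret h => exact hg _ _ h
  | op hN hP _ ih => exact hH _ _ hN _ _ hP _ _ ih

/-- Splitting `h` into its fields and leaving the type a variable of the motive `P` frees the
dependent case split from unifying projections. -/
theorem VDen.handler_elim {Γ : Ctx} {cr : Comp} {h : Clauses} {T : VTy} {d : Γ.env → T.sem}
    {P : (T : VTy) → (Γ.env → T.sem) → Prop} (hd : VDen Γ (.handler cr h) T d)
    (hP : ∀ {A : VTy} {S : Sig} {E : Theory} {D : CTy}
      {g : (Γ.cons A).env → D.sem} {H : Γ.env → Interp S D.sem},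
      CDen (Γ.cons A) cr D g → HDen Γ h S D H →
      P (.handler (cty A S E) D) (fun η => lift (H η) (fun a => g (η, a)))) : P T d := by
  obtain ⟨n, name, body⟩ := h
  cases hd with
  | handler h₁ h₂ => exact hP h₁ h₂

theorem CDen.op_elim {Γ : Ctx} {o : OpName} {v : Val} {c : Comp} {C : CTy} {d : Γ.env → C.sem}
    {P : (C : CTy) → (Γ.env → C.sem) → Prop} (hd : CDen Γ (.op o v c) C d)
    (hP : ∀ {A : VTy} {S : Sig} {E : Theory} {i : Fin S.n}
      {d : Γ.env → (S.par i).sem} {κ : (Γ.cons (S.res i)).env → (cty A S E).sem},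
      S.name i = o → VDen Γ v (S.par i) d → CDen (Γ.cons (S.res i)) c (cty A S E) κ →
      P (cty A S E) (fun η => Tree.op i (d η) (fun b => κ (η, b)))) : P C d := by
  cases hd with
  | op h₁ h₂ => exact hP rfl h₁ h₂

-- Induction on one derivation, inversion of the other. The types of an applied argument, of a
-- handled computation or of a bound variable may differ between the two. Since binders put such
-- types into the context, the contexts must be allowed to differ as well.
mutual
theorem VDen.het {Γ : Ctx} : {v : Val} → {A : VTy} → {d : Γ.env → A.sem} → VDen Γ v A d →
    ∀ {Γ' A'} {d' : Γ'.env → VTy.sem A'}, VDen Γ' v A' d' →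
      ∀ η η', Γ.het Γ' η η' → A.het A' (d η) (d' η')
  | _, _, _, .var h => fun h' η η' hη => by
      cases h' with
      | var h' => exact h.het h' _ _ hη
  | _, _, _, .unit => fun h' η η' hη => by
      cases h'; trivial
  | _, _, _, .tt => fun h' η η' hη => by
      cases h'; rfl
  | _, _, _, .ff => fun h' η η' hη => by
      cases h'; rfl
  | _, _, _, .lam h => fun h' η η' hη => by
      cases h' with
      | lam h' => exact fun a a' ha => h.het h' (η, a) (η', a') ⟨hη, ha⟩
  | _, _, _, .handler h₁ h₂ => fun h' η η' hη => by
      refine h'.handler_elim (P := fun T d' => VTy.het _ T _ (d' η')) ?_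
      intro A' S' E' D' g' H' h₁' h₂' t t' ht
      exact lift_het (h₂.het h₂' η η' hη)
        (fun a a' ha => h₁.het h₁' (η, a) (η', a') ⟨hη, ha⟩) ht

theorem CDen.het {Γ : Ctx} : {c : Comp} → {C : CTy} → {d : Γ.env → C.sem} → CDen Γ c C d →
    ∀ {Γ' C'} {d' : Γ'.env → CTy.sem C'}, CDen Γ' c C' d' →
      ∀ η η', Γ.het Γ' η η' → C.het C' (d η) (d' η')
  | _, _, _, @CDen.ite _ _ _ _ _ b _ _ h₀ h₁ h₂ => fun h' η η' hη => by
      cases h' with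
      | @ite _ _ _ _ _ b' _ _ h₀' h₁' h₂' =>
        have hb : b η = b' η' := h₀.het h₀' η η' hη
        have e₁ := h₁.het h₁' η η' hη
        have e₂ := h₂.het h₂' η η' hη
        simp only [← hb]
        cases b η
        · exact e₂
        · exact e₁
  | _, _, _, .app h₁ h₂ => fun h' η η' hη => by
      cases h' with
      | app h₁' h₂' => exact h₁.het h₁' η η' hη _ _ (h₂.het h₂' η η' hη)
  | _, _, _, .ret h => fun h' η η' hη => by
      cases h' with
      | ret h' => exact TreeHet.ret (h.het h' η η' hη)
  | _, _, _, .op h₁ h₂ => fun h' η η' hη => by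
      refine h'.op_elim (P := fun T d' => CTy.het _ T _ (d' η')) ?_
      intro A' S' E' i' d' κ' hN h₁' h₂'
      exact TreeHet.op hN.symm (h₁.het h₁' η η' hη)
        fun b b' hb => h₂.het h₂' (η, b) (η', b') ⟨hη, hb⟩
  | _, _, _, @CDen.bind _ A B S E _ _ _ _ h₁ h₂ => fun h' η η' hη => by
      cases h' with
      | @bind _ A' B' S' E' _ _ _ _ h₁' h₂' =>
        exact lift_het (D := cty B S E) (D' := cty B' S' E')
          (fun i i' hN a a' ha κ κ' hκ => TreeHet.op hN ha hκ)
          (fun a a' ha => h₂.het h₂' (η, a) (η', a') ⟨hη, ha⟩) (h₁.het h₁' η η' hη)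
  | _, _, _, .handle h₁ h₂ => fun h' η η' hη => by
      cases h' with
      | handle h₁' h₂' => exact h₁.het h₁' η η' hη _ _ (h₂.het h₂' η η' hη)

theorem HDen.het {Γ : Ctx} : {h : Clauses} → {S : Sig} → {D : CTy} →
    {H : Γ.env → Interp S D.sem} → HDen Γ h S D H →
    ∀ {Γ' S' D'} {H' : Γ'.env → Interp S' (CTy.sem D')}, HDen Γ' h S' D' H' →
      ∀ η η', Γ.het Γ' η η' → ∀ i i', S.name i = S'.name i' →
        ∀ a a', (S.par i).het (S'.par i') a a' →
        ∀ κ κ', (∀ b b', (S.res i).het (S'.res i') b b' → D.het D' (κ b) (κ' b')) →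
          D.het D' (H η i a κ) (H' η' i' a' κ')
  | h, _, _, _, .mk e he hd => fun h' η η' hη i i' hN a a' ha κ κ' hκ => by
      cases h' with
      | mk e' he' hd' =>
        -- Both bijections locate a clause by its name and clause names are distinct, so matching
        -- operations select the same body.
        have hi : e i = e' i' := h.name.injective ((he i).trans (hN.trans (he' i').symm))
        have h₁' := hd' i'
        rw [← hi] at h₁'
        exact (hd i).het h₁' ((η, a), κ) ((η', a'), κ') ⟨⟨hη, ha⟩, hκ⟩
end

/-- Coherence at a single type and context, where `het` relates each environment to itself and
relatedness is equality. -/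
theorem VDen.unique {Γ : Ctx} {v : Val} {A : VTy} {d d' : Γ.env → A.sem}
    (h : VDen Γ v A d) (h' : VDen Γ v A d') : d = d' :=
  funext fun η => (A.het_self _ _).1 (h.het h' η η (Γ.het_refl η))

theorem CDen.unique {Γ : Ctx} {c : Comp} {C : CTy} {d d' : Γ.env → C.sem}
    (h : CDen Γ c C d) (h' : CDen Γ c C d') : d = d' :=
  funext fun η => (C.het_self _ _).1 (h.het h' η η (Γ.het_refl η))

-- Inversion of denotations and uniqueness for templates

/-- The components of a computation type. -/
def CTy.parts : CTy → VTy × Sig × Theory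
  | .mk A n name par res m vars k tvars lhs rhs =>
    (A, ⟨n, name, par, res⟩, ⟨m, fun e => ⟨vars e, k e, tvars e, lhs e, rhs e⟩⟩)

theorem cty_inj {A A' : VTy} {S S' : Sig} {E E' : Theory} (h : cty A S E = cty A' S' E') :
    A = A' ∧ S = S' ∧ E = E' := by
  have h : (A, S, E) = (A', S', E') := congrArg CTy.parts h
  simpa using h

/-- The eliminator yields an equation between handler types. The type of the denotation depends on
it, hence the heterogeneous equality until `cty_inj` has identified the components. -/
theorem VDen.handler_inv {Γ : Ctx} {cr : Comp} {h : Clauses} {A : VTy} {S : Sig} {E : Theory}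
    {D : CTy} {d : Γ.env → (cty A S E).sem → D.sem}
    (hd : VDen Γ (.handler cr h) (.handler (cty A S E) D) d) :
    ∃ (g : (Γ.cons A).env → D.sem) (H : Γ.env → Interp S D.sem),
      CDen (Γ.cons A) cr D g ∧ HDen Γ h S D H ∧
        d = fun η => lift (H η) (fun a => g (η, a)) := by
  have key := hd.handler_elim (P := fun T d => T = .handler (cty A S E) D →
    ∃ (g : (Γ.cons A).env → D.sem) (H : Γ.env → Interp S D.sem),
      CDen (Γ.cons A) cr D g ∧ HDen Γ h S D H ∧
        HEq d (fun (η : Γ.env) => lift (H η) (fun a => g (η, a)))) ?_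
  · obtain ⟨g, H, h₁, h₂, h₃⟩ := key rfl
    exact ⟨g, H, h₁, h₂, eq_of_heq h₃⟩
  · intro A' S' E' D' g H h₁ h₂ hT
    obtain ⟨hC, rfl⟩ := VTy.handler.inj hT
    obtain ⟨rfl, rfl, rfl⟩ := cty_inj hC
    exact ⟨g, H, h₁, h₂, HEq.rfl⟩

theorem TDen.app_elim {S : Sig} {k : ℕ} {Z : Fin k → VTy} {Γ : Ctx} {z : ℕ} {v : Val}
    {t : (Y : Type) → Interp S Y → Γ.env → TEnv Z Y → Y} (h : TDen S Z Γ (.app z v) t) :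
    ∃ (j : Fin k) (d : Γ.env → (Z j).sem), z = j ∧ VDen Γ v (Z j) d ∧
      t = fun _ _ η ζ => ζ j (d η) := by
  cases h with
  | app h => exact ⟨_, _, rfl, h, rfl⟩

theorem TDen.op_elim {S : Sig} {k : ℕ} {Z : Fin k → VTy} {Γ : Ctx} {o : OpName} {v : Val}
    {T : Tmpl} {t : (Y : Type) → Interp S Y → Γ.env → TEnv Z Y → Y}
    (h : TDen S Z Γ (.op o v T) t) :
    ∃ (i : Fin S.n) (d : Γ.env → (S.par i).sem)
      (t' : (Y : Type) → Interp S Y → (Γ.cons (S.res i)).env → TEnv Z Y → Y),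
      o = S.name i ∧ VDen Γ v (S.par i) d ∧ TDen S Z (Γ.cons (S.res i)) T t' ∧
      t = fun Y H η ζ => H i (d η) (fun b => t' Y H (η, b) ζ) := by
  cases h with
  | op h₁ h₂ => exact ⟨_, _, _, rfl, h₁, h₂, rfl⟩

/-- The signature and template context are fixed, so operation names and template variables
determine all intermediate types, and uniqueness for values suffices. -/
theorem TDen.unique {S : Sig} {k : ℕ} {Z : Fin k → VTy} {Γ : Ctx} {T : Tmpl}
    {t t' : (Y : Type) → Interp S Y → Γ.env → TEnv Z Y → Y}
    (h : TDen S Z Γ T t) (h' : TDen S Z Γ T t') : t = t' := by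
  induction h with
  | app h =>
    obtain ⟨j, d, hj, h₁, rfl⟩ := h'.app_elim
    obtain rfl := Fin.val_injective hj
    rw [h.unique h₁]
  | ite h₀ _ _ ih₁ ih₂ =>
    cases h' with
    | ite h₀' h₁' h₂' => rw [h₀.unique h₀', ih₁ h₁', ih₂ h₂']
  | op h _ ih =>
    obtain ⟨i, d, t', hi, h₁, h₂, rfl⟩ := h'.op_elim
    obtain rfl := S.name.injective hi
    rw [h.unique h₁, ih h₂]


/-! ## Renaming and substitution -/

/-- The renaming `ρ` from `Γ` to `Γ'` denotes `r`. -/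
def RenDen (Γ' Γ : Ctx) (ρ : ℕ → ℕ) (r : Γ'.env → Γ.env) : Prop :=
  ∀ i A p, Lookup Γ i A p → Lookup Γ' (ρ i) A (fun η => p (r η))

/-- The substitution `σ` from `Γ` to `Γ'` denotes `s`. -/
def SubDen (Γ' Γ : Ctx) (σ : ℕ → Val) (s : Γ'.env → Γ.env) : Prop :=
  ∀ i A p, Lookup Γ i A p → VDen Γ' (σ i) A (fun η => p (s η))

theorem RenDen.lift {Γ' Γ : Ctx} {ρ : ℕ → ℕ} {r : Γ'.env → Γ.env} (h : RenDen Γ' Γ ρ r)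
    (A : VTy) : RenDen (Γ'.cons A) (Γ.cons A) (liftRen ρ) (fun η => (r η.1, η.2)) := by
  intro i B p hp
  cases hp with
  | zero => exact .zero
  | succ hp => exact .succ (h _ _ _ hp)

theorem RenDen.succ (Γ : Ctx) (A : VTy) : RenDen (Γ.cons A) Γ (· + 1) (fun η => η.1) :=
  fun _ _ _ hp => .succ hp

theorem RenDen.comp_succ {Γ' Γ : Ctx} {s : ℕ} {r : Γ'.env → Γ.env} (h : RenDen Γ' Γ (· + s) r)
    (A : VTy) : RenDen (Γ'.cons A) Γ (· + (s + 1)) (fun η => r η.1) :=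
  fun _ _ _ hp => .succ (h _ _ _ hp)

mutual
theorem VDen.rename {Γ : Ctx} : {v : Val} → {A : VTy} → {d : Γ.env → A.sem} → VDen Γ v A d →
    ∀ {Γ' ρ r}, RenDen Γ' Γ ρ r → VDen Γ' (v.rename ρ) A (fun η => d (r η))
  | _, _, _, .var h => fun hr => .var (hr _ _ _ h)
  | _, _, _, .unit => fun _ => .unit
  | _, _, _, .tt => fun _ => .tt
  | _, _, _, .ff => fun _ => .ff
  | _, _, _, .lam h => fun hr => .lam (h.rename (hr.lift _))
  | _, _, _, @VDen.handler _ _ _ _ _ _ h _ _ h₁ h₂ => fun hr =>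
    VDen.handler (h := h.rename _) (h₁.rename (hr.lift _)) (h₂.rename hr)

theorem CDen.rename {Γ : Ctx} : {c : Comp} → {C : CTy} → {d : Γ.env → C.sem} → CDen Γ c C d →
    ∀ {Γ' ρ r}, RenDen Γ' Γ ρ r → CDen Γ' (c.rename ρ) C (fun η => d (r η))
  | _, _, _, .ite h₀ h₁ h₂ => fun hr => .ite (h₀.rename hr) (h₁.rename hr) (h₂.rename hr)
  | _, _, _, .app h₁ h₂ => fun hr => .app (h₁.rename hr) (h₂.rename hr)
  | _, _, _, .ret h => fun hr => .ret (h.rename hr)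
  | _, _, _, .op h₁ h₂ => fun hr => .op (h₁.rename hr) (h₂.rename (hr.lift _))
  | _, _, _, .bind h₁ h₂ => fun hr => .bind (h₁.rename hr) (h₂.rename (hr.lift _))
  | _, _, _, .handle h₁ h₂ => fun hr => .handle (h₁.rename hr) (h₂.rename hr)

theorem HDen.rename {Γ : Ctx} : {h : Clauses} → {S : Sig} → {D : CTy} →
    {H : Γ.env → Interp S D.sem} → HDen Γ h S D H →
    ∀ {Γ' ρ r}, RenDen Γ' Γ ρ r → HDen Γ' (h.rename ρ) S D (fun η => H (r η))
  | _, _, _, _, .mk e he hd => fun hr =>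
    HDen.mk (h := Clauses.rename _ _) e he fun i => (hd i).rename ((hr.lift _).lift _)
end

theorem SubDen.lift {Γ' Γ : Ctx} {σ : ℕ → Val} {s : Γ'.env → Γ.env} (h : SubDen Γ' Γ σ s)
    (A : VTy) : SubDen (Γ'.cons A) (Γ.cons A) (liftSub σ) (fun η => (s η.1, η.2)) := by
  intro i B p hp
  cases hp with
  | zero => exact .var .zero
  | succ hp => exact (h _ _ _ hp).rename (RenDen.succ Γ' A)

/-- Substitution in operation clauses. -/
def Clauses.subst (h : Clauses) (σ : ℕ → Val) : Clauses :=
  ⟨h.n, h.name, fun i => (h.body i).subst (liftSub (liftSub σ))⟩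

mutual
theorem VDen.subst {Γ : Ctx} : {v : Val} → {A : VTy} → {d : Γ.env → A.sem} → VDen Γ v A d →
    ∀ {Γ' σ s}, SubDen Γ' Γ σ s → VDen Γ' (v.subst σ) A (fun η => d (s η))
  | _, _, _, .var h => fun hr => hr _ _ _ h
  | _, _, _, .unit => fun _ => .unit
  | _, _, _, .tt => fun _ => .tt
  | _, _, _, .ff => fun _ => .ff
  | _, _, _, .lam h => fun hr => .lam (h.subst (hr.lift _))
  | _, _, _, @VDen.handler _ _ _ _ _ _ h _ _ h₁ h₂ => fun hr =>
    VDen.handler (h := h.subst _) (h₁.subst (hr.lift _)) (h₂.subst hr)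

theorem CDen.subst {Γ : Ctx} : {c : Comp} → {C : CTy} → {d : Γ.env → C.sem} → CDen Γ c C d →
    ∀ {Γ' σ s}, SubDen Γ' Γ σ s → CDen Γ' (c.subst σ) C (fun η => d (s η))
  | _, _, _, .ite h₀ h₁ h₂ => fun hr => .ite (h₀.subst hr) (h₁.subst hr) (h₂.subst hr)
  | _, _, _, .app h₁ h₂ => fun hr => .app (h₁.subst hr) (h₂.subst hr)
  | _, _, _, .ret h => fun hr => .ret (h.subst hr)
  | _, _, _, .op h₁ h₂ => fun hr => .op (h₁.subst hr) (h₂.subst (hr.lift _))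
  | _, _, _, .bind h₁ h₂ => fun hr => .bind (h₁.subst hr) (h₂.subst (hr.lift _))
  | _, _, _, .handle h₁ h₂ => fun hr => .handle (h₁.subst hr) (h₂.subst hr)

theorem HDen.subst {Γ : Ctx} : {h : Clauses} → {S : Sig} → {D : CTy} →
    {H : Γ.env → Interp S D.sem} → HDen Γ h S D H →
    ∀ {Γ' σ s}, SubDen Γ' Γ σ s → HDen Γ' (h.subst σ) S D (fun η => H (s η))
  | _, _, _, _, .mk e he hd => fun hr =>
    HDen.mk (h := Clauses.subst _ _) e he fun i => (hd i).subst ((hr.lift _).lift _)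
end

theorem SubDen.sub1 {Γ : Ctx} {v : Val} {A : VTy} {d : Γ.env → A.sem} (h : VDen Γ v A d) :
    SubDen Γ (Γ.cons A) (sub1 v) (fun η => (η, d η)) := by
  intro i B p hp
  cases hp with
  | zero => exact h
  | succ hp => exact .var hp

theorem SubDen.sub2 {Γ : Ctx} {v w : Val} {A B : VTy} {d : Γ.env → A.sem} {d' : Γ.env → B.sem}
    (h : VDen Γ v A d) (h' : VDen Γ w B d') :
    SubDen Γ ((Γ.cons A).cons B) (sub2 v w) (fun η => ((η, d η), d' η)) := by
  intro i B p hp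
  cases hp with
  | zero => exact h'
  | succ hp =>
    cases hp with
    | zero => exact h
    | succ hp => exact .var hp

-- Renaming as substitution by variables, and the identity renaming

theorem liftSub_var (ρ : ℕ → ℕ) :
    liftSub (fun i => .var (ρ i)) = fun i => .var (liftRen ρ i) := by
  funext i
  cases i with
  | zero => rfl
  | succ i => simp only [liftSub, Val.rename, liftRen]

mutual
theorem Val.subst_var : (v : Val) → ∀ ρ : ℕ → ℕ, v.subst (fun i => .var (ρ i)) = v.rename ρ
  | .var i, ρ => rfl
  | .unit, ρ => rfl
  | .tt, ρ => rfl
  | .ff, ρ => rfl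
  | .lam c, ρ => by simp only [Val.subst, Val.rename, liftSub_var, c.subst_var]
  | .mkHandler cr n name body, ρ => by
    simp only [Val.subst, Val.rename, liftSub_var, cr.subst_var, fun i => (body i).subst_var]

theorem Comp.subst_var : (c : Comp) → ∀ ρ : ℕ → ℕ, c.subst (fun i => .var (ρ i)) = c.rename ρ
  | .ite v c₁ c₂, ρ => by
    simp only [Comp.subst, Comp.rename, v.subst_var, c₁.subst_var, c₂.subst_var]
  | .app v w, ρ => by simp only [Comp.subst, Comp.rename, v.subst_var, w.subst_var]
  | .ret v, ρ => by simp only [Comp.subst, Comp.rename, v.subst_var]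
  | .op o v c, ρ => by
    simp only [Comp.subst, Comp.rename, liftSub_var, v.subst_var, c.subst_var]
  | .bind c₁ c₂, ρ => by
    simp only [Comp.subst, Comp.rename, liftSub_var, c₁.subst_var, c₂.subst_var]
  | .handle v c, ρ => by simp only [Comp.subst, Comp.rename, v.subst_var, c.subst_var]
end

/-- Lets weakening of formulae inherit its semantics from substitution. -/
theorem Fm.subst_var (φ : Fm) : ∀ ρ : ℕ → ℕ, φ.subst (fun i => .var (ρ i)) = φ.rename ρ := by
  induction φ <;> intro ρ <;>
    simp_all only [Fm.subst, Fm.rename, Val.subst_var, Comp.subst_var, liftSub_var]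

/-- In `Γ.append Δ` the variables of `Δ` keep their indices, so the passage from `Δ` is the identity
renaming on syntax although it is a projection on environments. -/
theorem liftRen_id : liftRen id = id := by
  funext i; cases i <;> rfl

mutual
theorem Val.rename_id : (v : Val) → v.rename id = v
  | .var i => rfl
  | .unit => rfl
  | .tt => rfl
  | .ff => rfl
  | .lam c => by simp only [Val.rename, liftRen_id, c.rename_id]
  | .mkHandler cr n name body => by
    simp only [Val.rename, liftRen_id, cr.rename_id, fun i => (body i).rename_id]

theorem Comp.rename_id : (c : Comp) → c.rename id = c
  | .ite v c₁ c₂ => by simp only [Comp.rename, v.rename_id, c₁.rename_id, c₂.rename_id]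
  | .app v w => by simp only [Comp.rename, v.rename_id, w.rename_id]
  | .ret v => by simp only [Comp.rename, v.rename_id]
  | .op o v c => by simp only [Comp.rename, liftRen_id, v.rename_id, c.rename_id]
  | .bind c₁ c₂ => by simp only [Comp.rename, liftRen_id, c₁.rename_id, c₂.rename_id]
  | .handle v c => by simp only [Comp.rename, v.rename_id, c.rename_id]
end

/-! ## Logical relations on one type -/

mutual
theorem VTy.rel_symm : (A : VTy) → ∀ {a a' : A.sem}, A.rel a a' → A.rel a' a
  | .unit => fun h => Eq.symm h
  | .bool => fun h => Eq.symm h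
  | .fn A C => fun h a a' ha => C.rel_symm (h a' a (A.rel_symm ha))
  | .handler C D => fun h a a' ha => D.rel_symm (h a' a (C.rel_symm ha))

theorem CTy.rel_symm : (C : CTy) → ∀ {t t' : C.sem}, C.rel t t' → C.rel t' t
  | .mk .. => fun h => TreeRel.symm h
end

-- Reflexivity is not available in general. The intermediate comparison at `a` needs `a ∼ a`, which
-- follows from `a ∼ a'` by symmetry and transitivity at the argument type.
mutual
theorem VTy.rel_trans : (A : VTy) → ∀ {a b c : A.sem}, A.rel a b → A.rel b c → A.rel a c
  | .unit => fun h h' => Eq.trans h h'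
  | .bool => fun h h' => Eq.trans h h'
  | .fn A C => fun h h' a a' ha =>
    C.rel_trans (h a a (A.rel_trans ha (A.rel_symm ha))) (h' a a' ha)
  | .handler C D => fun h h' a a' ha =>
    D.rel_trans (h a a (C.rel_trans ha (C.rel_symm ha))) (h' a a' ha)

theorem CTy.rel_trans : (C : CTy) → ∀ {t t' t'' : C.sem}, C.rel t t' → C.rel t' t'' → C.rel t t''
  | .mk .. => fun h h' => TreeRel.trans h h'
end

theorem Ctx.rel_symm : (Γ : Ctx) → ∀ {η η' : Γ.env}, Γ.rel η η' → Γ.rel η' η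
  | .nil => fun _ => trivial
  | .cons Γ A => fun h => ⟨Γ.rel_symm h.1, A.rel_symm h.2⟩

theorem Ctx.rel_trans : (Γ : Ctx) → ∀ {η η' η'' : Γ.env},
    Γ.rel η η' → Γ.rel η' η'' → Γ.rel η η''
  | .nil => fun _ _ => trivial
  | .cons Γ A => fun h h' => ⟨Γ.rel_trans h.1 h'.1, A.rel_trans h.2 h'.2⟩

theorem VTy.rel_left (A : VTy) {a a' : A.sem} (h : A.rel a a') : A.rel a a :=
  A.rel_trans h (A.rel_symm h)

theorem VTy.rel_right (A : VTy) {a a' : A.sem} (h : A.rel a a') : A.rel a' a' :=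
  A.rel_trans (A.rel_symm h) h

theorem CTy.rel_left (C : CTy) {t t' : C.sem} (h : C.rel t t') : C.rel t t :=
  C.rel_trans h (C.rel_symm h)

theorem Ctx.rel_left (Γ : Ctx) {η η' : Γ.env} (h : Γ.rel η η') : Γ.rel η η :=
  Γ.rel_trans h (Γ.rel_symm h)

theorem Ctx.rel_right (Γ : Ctx) {η η' : Γ.env} (h : Γ.rel η η') : Γ.rel η' η' :=
  Γ.rel_trans (Γ.rel_symm h) h

theorem Lookup.rel {Γ : Ctx} {i : ℕ} {A : VTy} {p : Γ.env → A.sem} (h : Lookup Γ i A p) :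
    ∀ η η', Γ.rel η η' → A.rel (p η) (p η') := by
  induction h with
  | zero => exact fun _ _ h => h.2
  | succ _ ih => exact fun _ _ h => ih _ _ h.1

theorem Ctx.exists_lookup : (Γ : Ctx) → ∀ {i : ℕ} {A : VTy}, Γ.get? i = some A →
    ∃ p, Lookup Γ i A p
  | .cons _ _, 0, _, h => by
    obtain rfl := Option.some.inj h
    exact ⟨_, .zero⟩
  | .cons Γ _, _ + 1, _, h =>
    let ⟨_, hp⟩ := Γ.exists_lookup (show Γ.get? _ = some _ from h)
    ⟨_, .succ hp⟩

/-! ## Templates -/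

/-- `lift H g` is a homomorphism from the free interpretation to `H`, and templates are built from
operations, branching and template variables only. -/
theorem TDen.lift {S : Sig} {k : ℕ} {Z : Fin k → VTy} {Γ : Ctx} {T : Tmpl}
    {t : (Y : Type) → Interp S Y → Γ.env → TEnv Z Y → Y} (h : TDen S Z Γ T t) {X Y : Type}
    (H : Interp S Y) (g : X → Y) (ζ : TEnv Z (S.Free X)) : ∀ η,
    lift H g (t _ (freeInterp S X) η ζ) = t Y H η (fun j b => LPred.lift H g (ζ j b)) := by
  induction h with
  | app h => exact fun _ => rfl
  | @ite _ _ _ _ b _ _ h₀ _ _ ih₁ ih₂ =>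
    intro η
    cases hb : b η
    · simpa [hb] using ih₂ η
    · simpa [hb] using ih₁ η
  | @op _ i _ _ d _ h _ ih =>
    intro η
    exact congrArg (H i (d η)) (funext fun b => ih (η, b))

/-- Instantiated operation calls remain calls, hence the free interpretation. The renaming is `id`
because the variables of the equation come last in `Γ`; this persists under the binder of an
operation. -/
theorem TDen.inst {A : VTy} {S : Sig} {E : Theory} {k : ℕ} {Z : Fin k → VTy} {Δ : Ctx} {T : Tmpl}
    {t : (Y : Type) → Interp S Y → Δ.env → TEnv Z Y → Y} (h : TDen S Z Δ T t) :
    ∀ {Γ : Ctx} {r : Γ.env → Δ.env} {f : ℕ → Val}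
      {F : (j : Fin k) → Γ.env → (Z j).sem → (cty A S E).sem},
      RenDen Γ Δ id r → (∀ j : Fin k, VDen Γ (f j) (.fn (Z j) (cty A S E)) (F j)) →
      CDen Γ (T.inst f) (cty A S E)
        (fun η => t _ (freeInterp S A.sem) (r η) (fun j => F j η)) := by
  induction h with
  | @app _ j v d h =>
    intro Γ r f F hr hf
    have := h.rename hr
    rw [Val.rename_id] at this
    exact .app (hf j) this
  | @ite _ v T₁ T₂ b t₁ t₂ h₀ _ _ ih₁ ih₂ =>
    intro Γ r f F hr hf
    have := h₀.rename hr
    rw [Val.rename_id] at this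
    exact .ite this (ih₁ hr hf) (ih₂ hr hf)
  | @op _ i v T d t h _ ih =>
    intro Γ r f F hr hf
    have := h.rename hr
    rw [Val.rename_id] at this
    have hr' := hr.lift (S.res i)
    rw [liftRen_id] at hr'
    exact .op this (ih (F := fun j (η : (Γ.cons (S.res i)).env) => F j η.1) hr' fun j => (hf j).rename (RenDen.succ _ _))

/-- A call becomes the clause body with the parameter for `x` and the abstracted, already handled
continuation for `k`. By the substitution lemma this denotes the interpretation of the operation
given by the clauses. -/
theorem TDen.handleWith {D : CTy} {S : Sig} {k : ℕ} {Z : Fin k → VTy} {Δ : Ctx} {T : Tmpl}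
    {t : (Y : Type) → Interp S Y → Δ.env → TEnv Z Y → Y} (h : TDen S Z Δ T t) :
    ∀ {Γ : Ctx} {ρ : ℕ → ℕ} {r : Γ.env → Δ.env} {h : Clauses} {H : Γ.env → Interp S D.sem}
      {f : ℕ → Val} {F : (j : Fin k) → Γ.env → (Z j).sem → D.sem},
      RenDen Γ Δ ρ r → HDen Γ h S D H → (∀ j : Fin k, VDen Γ (f j) (.fn (Z j) D) (F j)) →
      CDen Γ ((T.rename ρ).handleWith h f) D
        (fun η => t _ (H η) (r η) (fun j => F j η)) := by
  induction h with
  | @app _ j v d h =>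
    intro Γ ρ r c H f F hr hH hf
    exact .app (hf j) (h.rename hr)
  | @ite _ v T₁ T₂ b t₁ t₂ h₀ _ _ ih₁ ih₂ =>
    intro Γ ρ r c H f F hr hH hf
    exact .ite (h₀.rename hr) (ih₁ hr hH hf) (ih₂ hr hH hf)
  | @op _ i v T d t h _ ih =>
    intro Γ ρ r c H f F hr hH hf
    have body := ih (f := fun z => (f z).rename (· + 1)) (F := fun j (η : (Γ.cons (S.res i)).env) => F j η.1) (hr.lift (S.res i)) (hH.rename (RenDen.succ _ _))
      fun j => (hf j).rename (RenDen.succ _ _)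
    cases hH with
    | mk e he hd =>
      have ho : ∃ i', c.name i' = S.name i := ⟨e i, he i⟩
      -- The clause found by its name is the one given by the bijection, since clause names are
      -- distinct.
      have hi : ho.choose = e i := c.name.injective (ho.choose_spec.trans (he i).symm)
      simp only [Tmpl.rename, Tmpl.handleWith]
      rw [dif_pos ho, hi]
      exact (hd i).subst (SubDen.sub2 (h.rename hr) (.lam body))

/-! ## Composite contexts -/

theorem Ctx.rel_of_lookup : (Γ : Ctx) → ∀ {η η' : Γ.env},
    (∀ i A p, Lookup Γ i A p → A.rel (p η) (p η')) → Γ.rel η η'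
  | .nil, _, _, _ => trivial
  | .cons Γ _, _, _, h =>
    ⟨Γ.rel_of_lookup fun i A _ hp => h (i + 1) A _ (.succ hp), h 0 _ _ .zero⟩

/-- Environments are related as soon as all their projections are, so renamings preserve the
relation without further hypotheses. For substitutions this has to be carried along separately. -/
theorem RenDen.rel {Γ' Γ : Ctx} {ρ : ℕ → ℕ} {r : Γ'.env → Γ.env} (h : RenDen Γ' Γ ρ r)
    {η η' : Γ'.env} (hη : Γ'.rel η η') : Γ.rel (r η) (r η') :=
  Γ.rel_of_lookup fun i A p hp => (h i A p hp).rel η η' hη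

theorem Lookup.not_nil {i : ℕ} {A : VTy} {p : Ctx.nil.env → A.sem} : ¬ Lookup .nil i A p := by
  intro h
  cases h

/-- Environments of `Γ, Δ` are handled through two projections and a pairing. The final clause sorts
the variables by origin, as needed to interpret a substitution for the block `Δ`. -/
theorem Ctx.append_den (Γ : Ctx) : (Δ : Ctx) →
    ∃ (l : (Γ.append Δ).env → Γ.env) (r : (Γ.append Δ).env → Δ.env)
      (pair : Γ.env → Δ.env → (Γ.append Δ).env),
      RenDen (Γ.append Δ) Γ (· + Δ.length) l ∧ RenDen (Γ.append Δ) Δ id r ∧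
      (∀ η a, l (pair η a) = η) ∧ (∀ η a, r (pair η a) = a) ∧
      (∀ η η' a a', Γ.rel η η' → Δ.rel a a' → (Γ.append Δ).rel (pair η a) (pair η' a')) ∧
      ∀ i A p, Lookup (Γ.append Δ) i A p →
        (i < Δ.length ∧ ∃ q, Lookup Δ i A q ∧ p = fun x => q (r x)) ∨
        (Δ.length ≤ i ∧ ∃ q, Lookup Γ (i - Δ.length) A q ∧ p = fun x => q (l x))
  | .nil => ⟨id, fun _ => (), fun η _ => η, fun _ _ _ hp => hp,
      fun _ _ _ hp => (hp.not_nil).elim,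
      fun _ _ => rfl, fun _ _ => rfl, fun _ _ _ _ h _ => h,
      fun _ _ p hp => Or.inr ⟨Nat.zero_le _, p, hp, rfl⟩⟩
  | .cons Δ B => by
    obtain ⟨l, r, pair, hl, hr, hpl, hpr, hrel, hlook⟩ := Γ.append_den Δ
    refine ⟨fun x => l x.1, fun x => (r x.1, x.2), fun η a => (pair η a.1, a.2),
      hl.comp_succ B, ?_, fun η a => hpl _ _, fun η a => Prod.ext (hpr _ _) rfl,
      fun η η' a a' h h' => ⟨hrel _ _ _ _ h h'.1, h'.2⟩, ?_⟩
    · have := hr.lift B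
      rwa [liftRen_id] at this
    · intro i A p hp
      change Lookup (.cons _ _) _ _ _ at hp
      cases hp with
      | zero => exact .inl ⟨Nat.succ_pos _, _, .zero, rfl⟩
      | @succ _ _ _ i _ hp =>
        rcases hlook _ _ _ hp with ⟨hi, q, hq, rfl⟩ | ⟨hi, q, hq, rfl⟩
        · exact .inl ⟨Nat.succ_lt_succ hi, _, .succ hq, rfl⟩
        · refine .inr ⟨Nat.succ_le_succ hi, q, ?_, rfl⟩
          simpa [Ctx.length] using hq

theorem Ctx.addFns_den (Γ : Ctx) (D : CTy) : (k : ℕ) → (B : Fin k → VTy) →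
    ∃ (l : (Γ.addFns D k B).env → Γ.env)
      (pair : Γ.env → TEnv B D.sem → (Γ.addFns D k B).env),
      RenDen (Γ.addFns D k B) Γ (· + k) l ∧ (∀ η f, l (pair η f) = η) ∧
      (∀ j : Fin k, ∃ fn, Lookup (Γ.addFns D k B) (k - 1 - j) (.fn (B j) D) fn ∧
        ∀ η f, fn (pair η f) = f j) ∧
      ∀ η η' f f', Γ.rel η η' → (∀ j, (VTy.fn (B j) D).rel (f j) (f' j)) →
        (Γ.addFns D k B).rel (pair η f) (pair η' f')
  | 0, B => ⟨id, fun η _ => η, fun _ _ _ hp => hp, fun _ _ => rfl, fun j => j.elim0,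
      fun _ _ _ _ h _ => h⟩
  | k + 1, B => by
    obtain ⟨l, pair, hl, hpl, hfn, hrel⟩ := Γ.addFns_den D k (fun j => B j.castSucc)
    refine ⟨fun x => l x.1, fun η f => (pair η fun j => f j.castSucc, f (Fin.last k)),
      hl.comp_succ _, fun η f => hpl _ _, ?_,
      fun η η' f f' h h' => ⟨hrel _ _ _ _ h fun j => h' j.castSucc, h' (Fin.last k)⟩⟩
    refine Fin.lastCases ?_ fun j => ?_
    · refine ⟨fun x => x.2, ?_, fun _ _ => rfl⟩
      simp only [Fin.val_last, Nat.add_sub_cancel, Nat.sub_self]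
      exact Lookup.zero
    · obtain ⟨fn, h, hp⟩ := hfn j
      refine ⟨fun x => fn x.1, ?_, fun _ _ => hp _ _⟩
      -- The newly added function takes index `0`, so each earlier one moves up by one.
      have hj : k + 1 - 1 - (j.castSucc : ℕ) = k - 1 - j + 1 := by
        simp only [Fin.val_castSucc]; omega
      rw [hj]
      exact h.succ

/-! ## Semantic typing -/

/-- `v` has a denotation that preserves the logical relation. -/
def VOk (Γ : Ctx) (v : Val) (A : VTy) : Prop :=
  ∃ d, VDen Γ v A d ∧ ∀ η η', Γ.rel η η' → A.rel (d η) (d η')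

/-- `c` has a denotation that preserves the logical relation. -/
def COk (Γ : Ctx) (c : Comp) (C : CTy) : Prop :=
  ∃ d, CDen Γ c C d ∧ ∀ η η', Γ.rel η η' → C.rel (d η) (d η')

/-- Two interpretations map related arguments to results related by `r`. -/
def Interp.Rel {S : Sig} {Y : Type} (r : Y → Y → Prop) (H H' : Interp S Y) : Prop :=
  ∀ i a a', (S.par i).rel a a' → ∀ κ κ', (∀ b b', (S.res i).rel b b' → r (κ b) (κ' b')) →
    r (H i a κ) (H' i a' κ')

/-- `T` has a parametric denotation. -/
def TOk (S : Sig) {k : ℕ} (Z : Fin k → VTy) (Γ : Ctx) (T : Tmpl) : Prop :=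
  ∃ t, TDen S Z Γ T t ∧ ∀ (Y : Type) (r : Y → Y → Prop) (H H' : Interp S Y), Interp.Rel r H H' →
    ∀ η η', Γ.rel η η' → ∀ ζ ζ' : TEnv Z Y, (∀ j b b', (Z j).rel b b' → r (ζ j b) (ζ' j b')) →
      r (t Y H η ζ) (t Y H' η' ζ')

/-- All equations of `E` are between templates with parametric denotations. -/
def Theory.Ok (E : Theory) (S : Sig) : Prop :=
  ∀ e : Equation, e ∈ E → TOk S e.tvars e.vars e.lhs ∧ TOk S e.tvars e.vars e.rhs

/-- The effect theory of a computation type is semantically well-formed. -/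
def CTy.Ok : CTy → Prop
  | .mk _ n name par res m vars k tvars lhs rhs =>
    Theory.Ok ⟨m, fun e => ⟨vars e, k e, tvars e, lhs e, rhs e⟩⟩ ⟨n, name, par, res⟩

/-- The effect theories at the results of functions and at handlers are semantically
well-formed. -/
def VTy.Ok : VTy → Prop
  | .unit => True
  | .bool => True
  | .fn _ C => C.Ok
  | .handler C D => C.Ok ∧ D.Ok

/-- The clauses have a denotation that preserves the logical relation. -/
def ClausesOk (Γ : Ctx) (h : Clauses) (S : Sig) (D : CTy) : Prop :=
  ∃ H, HDen Γ h S D H ∧ ∀ η η', Γ.rel η η' → Interp.Rel D.rel (H η) (H η')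

/-- The interpretations `H` and `H'` over `D` map both sides of `e` to related elements. -/
def Equation.Respected {S : Sig} {D : CTy} (e : Equation) (H H' : Interp S D.sem) : Prop :=
  ∀ t₁ t₂, TDen S e.tvars e.vars e.lhs t₁ → TDen S e.tvars e.vars e.rhs t₂ →
    ∀ a a', e.vars.rel a a' →
    ∀ f f' : TEnv e.tvars D.sem, (∀ j, (VTy.fn (e.tvars j) D).rel (f j) (f' j)) →
      D.rel (t₁ D.sem H a f) (t₂ D.sem H' a' f')

/-- The clauses have a denotation that preserves the logical relation and respects `E`. -/
def RespectsOk (Γ : Ctx) (h : Clauses) (E : Theory) (S : Sig) (D : CTy) : Prop :=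
  E.Ok S ∧ ∃ H, HDen Γ h S D H ∧ (∀ η η', Γ.rel η η' → Interp.Rel D.rel (H η) (H η')) ∧
    ∀ e : Equation, e ∈ E → ∀ η η', Γ.rel η η' → e.Respected (H η) (H η')

theorem VOk.den {Γ : Ctx} {v : Val} {A : VTy} {d : Γ.env → A.sem} (h : VOk Γ v A)
    (hd : VDen Γ v A d) : ∀ η η', Γ.rel η η' → A.rel (d η) (d η') := by
  obtain ⟨d', hd', hr⟩ := h
  rwa [hd.unique hd']

/-- The indices `p`, `q` stay universally quantified during the induction: symmetry swaps them and
transitivity continues at `(q, q)`. In the equation case `TDen.lift` pushes the lifting into the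
template variables, where `hE` applies. The index type is general because it ranges over
environments for handlers and over `Bool` when two different continuations are compared. -/
theorem lift_rel {ι : Type} {A : VTy} {S : Sig} {E : Theory} {D : CTy} {R : ι → ι → Prop}
    (hs : ∀ p q, R p q → R q p) (ht : ∀ p q, R p q → R q q) {H : ι → Interp S D.sem}
    {g : ι → A.sem → D.sem} (hH : ∀ p q, R p q → Interp.Rel D.rel (H p) (H q))
    (hg : ∀ p q, R p q → ∀ a a', A.rel a a' → D.rel (g p a) (g q a'))
    (hE : ∀ e : Equation, e ∈ E → ∀ p q, R p q → e.Respected (H p) (H q))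
    {t t' : (cty A S E).sem} (h : (cty A S E).rel t t') :
    ∀ p q, R p q → D.rel (lift (H p) (g p) t) (lift (H q) (g q) t') := by
  change TreeRel S E _ _ _ _ _ _ _ at h
  induction h with
  | symm _ ih => exact fun p q h => D.rel_symm (ih q p (hs p q h))
  | trans _ _ ih₁ ih₂ => exact fun p q h => D.rel_trans (ih₁ p q h) (ih₂ q q (ht p q h))
  | ret h => exact fun p q hpq => hg p q hpq _ _ h
  | op h _ ih => exact fun p q hpq => hH p q hpq _ _ _ h _ _ fun b b' hb => ih b b' hb p q hpq
  | @eqn e t₁ t₂ a a' f f' h₁ h₂ ha _ ih =>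
    intro p q hpq
    rw [h₁.lift, h₂.lift]
    exact hE _ ⟨e, rfl⟩ p q hpq _ _ h₁ h₂ _ _ ha _ _ fun j b b' hb => ih j b b' hb p q hpq

theorem freeInterp_rel (A : VTy) (S : Sig) (E : Theory) :
    Interp.Rel (cty A S E).rel (freeInterp S A.sem) (freeInterp S A.sem) :=
  fun _ _ _ ha _ _ hκ => TreeRel.op ha hκ

/-- The relation on trees is closed under the equations by construction. This makes sequencing an
instance of `lift_rel`. -/
theorem freeInterp_respected (A : VTy) (S : Sig) (E : Theory) {e : Equation} (he : e ∈ E) :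
    e.Respected (D := cty A S E) (freeInterp S A.sem) (freeInterp S A.sem) := by
  obtain ⟨i, rfl⟩ := he
  exact fun t₁ t₂ h₁ h₂ a a' ha f f' hf => TreeRel.eqn h₁ h₂ ha hf

/-! ## Closure of semantic typing under the term formers -/

theorem VOk.lookup {Γ : Ctx} {i : ℕ} {A : VTy} (h : Γ.get? i = some A) : VOk Γ (.var i) A :=
  let ⟨p, hp⟩ := Γ.exists_lookup h
  ⟨p, .var hp, hp.rel⟩

theorem VOk.unit (Γ : Ctx) : VOk Γ .unit .unit := ⟨_, .unit, fun _ _ _ => rfl⟩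

theorem VOk.tt (Γ : Ctx) : VOk Γ .tt .bool := ⟨_, .tt, fun _ _ _ => rfl⟩

theorem VOk.ff (Γ : Ctx) : VOk Γ .ff .bool := ⟨_, .ff, fun _ _ _ => rfl⟩

theorem VOk.lam {Γ : Ctx} {A : VTy} {C : CTy} {c : Comp} (h : COk (Γ.cons A) c C) :
    VOk Γ (.lam c) (.fn A C) :=
  let ⟨_, hd, hr⟩ := h
  ⟨_, .lam hd, fun _ _ hη _ _ ha => hr _ _ ⟨hη, ha⟩⟩

/-- Here the respect condition pays off: without it the lifted map need not send trees identified by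
`E` to related results. -/
theorem VOk.handler {Γ : Ctx} {A : VTy} {S : Sig} {E : Theory} {D : CTy} {cr : Comp}
    {h : Clauses} (hc : COk (Γ.cons A) cr D) (hh : RespectsOk Γ h E S D) :
    VOk Γ (.handler cr h) (.handler (cty A S E) D) := by
  obtain ⟨g, hg, hgr⟩ := hc
  obtain ⟨-, H, hH, hHr, hHE⟩ := hh
  refine ⟨_, .handler hg hH, fun η η' hη t t' ht => ?_⟩
  exact lift_rel (R := Γ.rel) (fun _ _ h => Γ.rel_symm h) (fun _ _ h => Γ.rel_right h) (g := fun η a => g (η, a)) hHr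
    (fun p q hpq a a' ha => hgr _ _ ⟨hpq, ha⟩) hHE ht η η' hη

theorem COk.ite {Γ : Ctx} {v : Val} {c₁ c₂ : Comp} {C : CTy} (h : VOk Γ v .bool)
    (h₁ : COk Γ c₁ C) (h₂ : COk Γ c₂ C) : COk Γ (.ite v c₁ c₂) C := by
  obtain ⟨b, hb, hbr⟩ := h
  obtain ⟨d₁, hd₁, hr₁⟩ := h₁
  obtain ⟨d₂, hd₂, hr₂⟩ := h₂
  refine ⟨_, .ite hb hd₁ hd₂, fun η η' hη => ?_⟩
  have hbb : b η = b η' := hbr η η' hη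
  simp only [← hbb]
  cases b η
  · exact hr₂ η η' hη
  · exact hr₁ η η' hη

theorem COk.app {Γ : Ctx} {v w : Val} {A : VTy} {C : CTy} (h₁ : VOk Γ v (.fn A C))
    (h₂ : VOk Γ w A) : COk Γ (.app v w) C :=
  let ⟨_, hd₁, hr₁⟩ := h₁
  let ⟨_, hd₂, hr₂⟩ := h₂
  ⟨_, .app hd₁ hd₂, fun η η' hη => hr₁ η η' hη _ _ (hr₂ η η' hη)⟩

theorem COk.ret {Γ : Ctx} {v : Val} {A : VTy} (S : Sig) (E : Theory) (h : VOk Γ v A) :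
    COk Γ (.ret v) (cty A S E) :=
  let ⟨_, hd, hr⟩ := h
  ⟨_, .ret hd, fun η η' hη => TreeRel.ret (hr η η' hη)⟩

theorem COk.op {Γ : Ctx} {A : VTy} {S : Sig} {E : Theory} {i : Fin S.n} {v : Val} {c : Comp}
    (h₁ : VOk Γ v (S.par i)) (h₂ : COk (Γ.cons (S.res i)) c (cty A S E)) :
    COk Γ (.op (S.name i) v c) (cty A S E) :=
  let ⟨_, hd₁, hr₁⟩ := h₁
  let ⟨_, hd₂, hr₂⟩ := h₂
  ⟨_, .op hd₁ hd₂, fun η η' hη =>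
    TreeRel.op (hr₁ η η' hη) fun _ _ hb => hr₂ _ _ ⟨hη, hb⟩⟩

/-- Sequencing is handling with the free interpretation, whatever family of continuations is used.
-/
theorem bind_rel {A B : VTy} {S : Sig} {E : Theory} {ι : Type} {R : ι → ι → Prop}
    (hs : ∀ p q, R p q → R q p) (ht : ∀ p q, R p q → R q q)
    {g : ι → A.sem → (cty B S E).sem}
    (hg : ∀ p q, R p q → ∀ a a', A.rel a a' → (cty B S E).rel (g p a) (g q a'))
    {t t' : (cty A S E).sem} (h : (cty A S E).rel t t') (p q : ι) (hpq : R p q) :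
    (cty B S E).rel (lift (freeInterp S B.sem) (g p) t) (lift (freeInterp S B.sem) (g q) t') :=
  lift_rel (D := cty B S E) (H := fun _ => freeInterp S B.sem) hs ht
    (fun _ _ _ => freeInterp_rel B S E) hg
    (fun _ he _ _ _ => freeInterp_respected B S E he) h p q hpq

theorem COk.bind {Γ : Ctx} {A B : VTy} {S : Sig} {E : Theory} {c₁ c₂ : Comp}
    (h₁ : COk Γ c₁ (cty A S E)) (h₂ : COk (Γ.cons A) c₂ (cty B S E)) :
    COk Γ (.bind c₁ c₂) (cty B S E) := by
  obtain ⟨d₁, hd₁, hr₁⟩ := h₁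
  obtain ⟨d₂, hd₂, hr₂⟩ := h₂
  refine ⟨_, .bind hd₁ hd₂, fun η η' hη => ?_⟩
  exact bind_rel (R := Γ.rel) (fun _ _ h => Γ.rel_symm h) (fun _ _ h => Γ.rel_right h) (g := fun η a => d₂ (η, a))
    (fun p q hpq a a' ha => hr₂ _ _ ⟨hpq, ha⟩) (hr₁ η η' hη) η η' hη

theorem COk.handle {Γ : Ctx} {v : Val} {c : Comp} {C D : CTy} (h₁ : VOk Γ v (.handler C D))
    (h₂ : COk Γ c C) : COk Γ (.handle v c) D :=
  let ⟨_, hd₁, hr₁⟩ := h₁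
  let ⟨_, hd₂, hr₂⟩ := h₂
  ⟨_, .handle hd₁ hd₂, fun η η' hη => hr₁ η η' hη _ _ (hr₂ η η' hη)⟩

theorem ClausesOk.intro {Γ : Ctx} {h : Clauses} {S : Sig} {D : CTy} (e : Fin S.n ≃ Fin h.n)
    (he : ∀ i, h.name (e i) = S.name i)
    (hb : ∀ i, COk ((Γ.cons (S.par i)).cons (.fn (S.res i) D)) (h.body (e i)) D) :
    ClausesOk Γ h S D := by
  choose d hd hr using hb
  exact ⟨_, .mk e he hd, fun η η' hη i a a' ha κ κ' hκ => hr i _ _ ⟨⟨hη, ha⟩, hκ⟩⟩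

theorem TOk.app {S : Sig} {k : ℕ} {Z : Fin k → VTy} {Γ : Ctx} {j : Fin k} {v : Val}
    (h : VOk Γ v (Z j)) : TOk S Z Γ (.app j v) :=
  let ⟨_, hd, hr⟩ := h
  ⟨_, .app hd, fun _ _ _ _ _ η η' hη _ _ hζ => hζ j _ _ (hr η η' hη)⟩

theorem TOk.ite {S : Sig} {k : ℕ} {Z : Fin k → VTy} {Γ : Ctx} {v : Val} {T₁ T₂ : Tmpl}
    (h : VOk Γ v .bool) (h₁ : TOk S Z Γ T₁) (h₂ : TOk S Z Γ T₂) : TOk S Z Γ (.ite v T₁ T₂) := by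
  obtain ⟨b, hb, hbr⟩ := h
  obtain ⟨t₁, hd₁, hr₁⟩ := h₁
  obtain ⟨t₂, hd₂, hr₂⟩ := h₂
  refine ⟨_, .ite hb hd₁ hd₂, fun Y r H H' hH η η' hη ζ ζ' hζ => ?_⟩
  have hbb : b η = b η' := hbr η η' hη
  simp only [← hbb]
  cases b η
  · exact hr₂ Y r H H' hH η η' hη ζ ζ' hζ
  · exact hr₁ Y r H H' hH η η' hη ζ ζ' hζ

theorem TOk.op {S : Sig} {k : ℕ} {Z : Fin k → VTy} {Γ : Ctx} {i : Fin S.n} {v : Val} {T : Tmpl}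
    (h : VOk Γ v (S.par i)) (hT : TOk S Z (Γ.cons (S.res i)) T) :
    TOk S Z Γ (.op (S.name i) v T) :=
  let ⟨_, hd, hr⟩ := h
  let ⟨_, ht, htr⟩ := hT
  ⟨_, .op hd ht, fun Y r H H' hH η η' hη ζ ζ' hζ =>
    hH i _ _ (hr η η' hη) _ _ fun _ _ hb => htr Y r H H' hH _ _ ⟨hη, hb⟩ ζ ζ' hζ⟩

theorem VOk.subst {Γ Γ' : Ctx} {v : Val} {A : VTy} {σ : ℕ → Val} {s : Γ'.env → Γ.env}
    (h : VOk Γ v A) (hs : SubDen Γ' Γ σ s) (hr : ∀ η η', Γ'.rel η η' → Γ.rel (s η) (s η')) :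
    VOk Γ' (v.subst σ) A :=
  let ⟨_, hd, hdr⟩ := h
  ⟨_, hd.subst hs, fun _ _ hη => hdr _ _ (hr _ _ hη)⟩

theorem COk.subst {Γ Γ' : Ctx} {c : Comp} {C : CTy} {σ : ℕ → Val} {s : Γ'.env → Γ.env}
    (h : COk Γ c C) (hs : SubDen Γ' Γ σ s) (hr : ∀ η η', Γ'.rel η η' → Γ.rel (s η) (s η')) :
    COk Γ' (c.subst σ) C :=
  let ⟨_, hd, hdr⟩ := h
  ⟨_, hd.subst hs, fun _ _ hη => hdr _ _ (hr _ _ hη)⟩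

/-- A well-typed substitution has a denotation. -/
theorem exists_subDen (Γ' : Ctx) : (Γ : Ctx) → ∀ {σ : ℕ → Val},
    (∀ i A, Γ.get? i = some A → VOk Γ' (σ i) A) →
    ∃ s : Γ'.env → Γ.env, SubDen Γ' Γ σ s ∧ ∀ η η', Γ'.rel η η' → Γ.rel (s η) (s η')
  | .nil, _, _ => ⟨fun _ => (), fun _ _ _ (hp : Lookup .nil _ _ _) => (hp.not_nil).elim, fun _ _ _ => trivial⟩
  | .cons Γ B, σ, h => by
    obtain ⟨s, hs, hsr⟩ := exists_subDen Γ' Γ (σ := fun i => σ (i + 1)) fun i A hi => h (i + 1) A hi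
    obtain ⟨d, hd, hdr⟩ := h 0 B rfl
    refine ⟨fun η => (s η, d η), ?_, fun η η' hη => ⟨hsr η η' hη, hdr η η' hη⟩⟩
    intro i A p hp
    cases hp with
    | zero => exact hd
    | succ hp => exact hs _ _ _ hp

/-! ## Formulae -/

/-- All terms in the formula are semantically well-typed. -/
def Fm.Ok : Fm → Ctx → Prop
  | .veq v w A, Γ => VOk Γ v A ∧ VOk Γ w A
  | .ceq c c' C, Γ => COk Γ c C ∧ COk Γ c' C
  | .top, _ => True
  | .bot, _ => True
  | .and φ ψ, Γ => φ.Ok Γ ∧ ψ.Ok Γ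
  | .or φ ψ, Γ => φ.Ok Γ ∧ ψ.Ok Γ
  | .imp φ ψ, Γ => φ.Ok Γ ∧ ψ.Ok Γ
  | .all A φ, Γ => φ.Ok (Γ.cons A)
  | .ex A φ, Γ => φ.Ok (Γ.cons A)

theorem Fm.holds_veq {Γ : Ctx} {v w : Val} {A : VTy} {d₁ d₂ : Γ.env → A.sem}
    (h₁ : VDen Γ v A d₁) (h₂ : VDen Γ w A d₂) (η η' : Γ.env) :
    (Fm.veq v w A).holds Γ η η' ↔ A.rel (d₁ η) (d₂ η') := by
  constructor
  · rintro ⟨d₁', d₂', h₁', h₂', h⟩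
    rwa [h₁.unique h₁', h₂.unique h₂']
  · exact fun h => ⟨d₁, d₂, h₁, h₂, h⟩

theorem Fm.holds_ceq {Γ : Ctx} {c c' : Comp} {C : CTy} {d₁ d₂ : Γ.env → C.sem}
    (h₁ : CDen Γ c C d₁) (h₂ : CDen Γ c' C d₂) (η η' : Γ.env) :
    (Fm.ceq c c' C).holds Γ η η' ↔ C.rel (d₁ η) (d₂ η') := by
  constructor
  · rintro ⟨d₁', d₂', h₁', h₂', h⟩
    rwa [h₁.unique h₁', h₂.unique h₂']
  · exact fun h => ⟨d₁, d₂, h₁, h₂, h⟩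

theorem Fm.Ok.subst {φ : Fm} : ∀ {Γ Γ' : Ctx} {σ : ℕ → Val} {s : Γ'.env → Γ.env}, φ.Ok Γ →
    SubDen Γ' Γ σ s → (∀ η η', Γ'.rel η η' → Γ.rel (s η) (s η')) → (φ.subst σ).Ok Γ' := by
  induction φ with
  | veq => exact fun h hs hr => ⟨h.1.subst hs hr, h.2.subst hs hr⟩
  | ceq => exact fun h hs hr => ⟨h.1.subst hs hr, h.2.subst hs hr⟩
  | top => exact fun _ _ _ => trivial
  | bot => exact fun _ _ _ => trivial
  | and _ _ ih₁ ih₂ => exact fun h hs hr => ⟨ih₁ h.1 hs hr, ih₂ h.2 hs hr⟩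
  | or _ _ ih₁ ih₂ => exact fun h hs hr => ⟨ih₁ h.1 hs hr, ih₂ h.2 hs hr⟩
  | imp _ _ ih₁ ih₂ => exact fun h hs hr => ⟨ih₁ h.1 hs hr, ih₂ h.2 hs hr⟩
  | all A _ ih => exact fun h hs hr => ih h (hs.lift A) fun _ _ hη => ⟨hr _ _ hη.1, hη.2⟩
  | ex A _ ih => exact fun h hs hr => ih h (hs.lift A) fun _ _ hη => ⟨hr _ _ hη.1, hη.2⟩

/-- An equation holds only if its sides have denotations, and those of the substituted terms need
not come from the original ones. Well-typedness of `φ` supplies denotations before substitution, and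
uniqueness identifies their composites with those after it. Since `⊤` means relatedness of
environments, `s` must preserve relatedness. -/
theorem Fm.holds_subst {φ : Fm} : ∀ {Γ Γ' : Ctx} {σ : ℕ → Val} {s : Γ'.env → Γ.env}, φ.Ok Γ →
    SubDen Γ' Γ σ s → (∀ η η', Γ'.rel η η' → Γ.rel (s η) (s η')) → ∀ {η η'}, Γ'.rel η η' →
      ((φ.subst σ).holds Γ' η η' ↔ φ.holds Γ (s η) (s η')) := by
  induction φ with
  | veq =>
    intro Γ Γ' σ s h hs hr η η' hη
    obtain ⟨⟨d₁, h₁, -⟩, d₂, h₂, -⟩ := h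
    exact (holds_veq (h₁.subst hs) (h₂.subst hs) _ _).trans (holds_veq h₁ h₂ _ _).symm
  | ceq =>
    intro Γ Γ' σ s h hs hr η η' hη
    obtain ⟨⟨d₁, h₁, -⟩, d₂, h₂, -⟩ := h
    exact (holds_ceq (h₁.subst hs) (h₂.subst hs) _ _).trans (holds_ceq h₁ h₂ _ _).symm
  | top => exact fun _ _ hr _ _ hη => iff_of_true hη (hr _ _ hη)
  | bot => exact fun _ _ _ _ _ _ => Iff.rfl
  | and _ _ ih₁ ih₂ =>
    exact fun h hs hr _ _ hη => and_congr (ih₁ h.1 hs hr hη) (ih₂ h.2 hs hr hη)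
  | or _ _ ih₁ ih₂ =>
    exact fun h hs hr _ _ hη => or_congr (ih₁ h.1 hs hr hη) (ih₂ h.2 hs hr hη)
  | imp _ _ ih₁ ih₂ =>
    exact fun h hs hr _ _ hη => imp_congr (ih₁ h.1 hs hr hη) (ih₂ h.2 hs hr hη)
  | all A _ ih =>
    exact fun h hs hr _ _ hη => forall_congr' fun a => forall_congr' fun a' =>
      forall_congr' fun ha =>
        ih h (hs.lift A) (fun _ _ hη => ⟨hr _ _ hη.1, hη.2⟩) ⟨hη, ha⟩
  | ex A _ ih =>
    exact fun h hs hr _ _ hη => exists_congr fun a => exists_congr fun a' =>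
      and_congr_right fun ha =>
        ih h (hs.lift A) (fun _ _ hη => ⟨hr _ _ hη.1, hη.2⟩) ⟨hη, ha⟩

/-- Formulae are invariant under replacing environments by related ones. -/
theorem Fm.holds_congr {φ : Fm} : ∀ {Γ : Ctx}, φ.Ok Γ → ∀ {η₁ η₂ η₁' η₂'},
    Γ.rel η₁ η₂ → Γ.rel η₁' η₂' → Γ.rel η₁ η₁' → (φ.holds Γ η₁ η₁' ↔ φ.holds Γ η₂ η₂') := by
  induction φ with
  | veq v w A =>
    intro Γ h η₁ η₂ η₁' η₂' h₁ h₂ _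
    obtain ⟨⟨d, hd, hr⟩, d', hd', hr'⟩ := h
    rw [holds_veq hd hd', holds_veq hd hd']
    exact ⟨fun h => A.rel_trans (hr _ _ (Γ.rel_symm h₁)) (A.rel_trans h (hr' _ _ h₂)),
      fun h => A.rel_trans (hr _ _ h₁) (A.rel_trans h (hr' _ _ (Γ.rel_symm h₂)))⟩
  | ceq c c' C =>
    intro Γ h η₁ η₂ η₁' η₂' h₁ h₂ _
    obtain ⟨⟨d, hd, hr⟩, d', hd', hr'⟩ := h
    rw [holds_ceq hd hd', holds_ceq hd hd']
    exact ⟨fun h => C.rel_trans (hr _ _ (Γ.rel_symm h₁)) (C.rel_trans h (hr' _ _ h₂)),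
      fun h => C.rel_trans (hr _ _ h₁) (C.rel_trans h (hr' _ _ (Γ.rel_symm h₂)))⟩
  | top =>
    exact fun {Γ} _ _ _ _ _ h₁ h₂ h => iff_of_true h
      (Γ.rel_trans (Γ.rel_symm h₁) (Γ.rel_trans h h₂))
  | bot => exact fun _ _ _ _ _ _ _ _ => Iff.rfl
  | and _ _ ih₁ ih₂ =>
    exact fun h _ _ _ _ h₁ h₂ h₃ => and_congr (ih₁ h.1 h₁ h₂ h₃) (ih₂ h.2 h₁ h₂ h₃)
  | or _ _ ih₁ ih₂ =>
    exact fun h _ _ _ _ h₁ h₂ h₃ => or_congr (ih₁ h.1 h₁ h₂ h₃) (ih₂ h.2 h₁ h₂ h₃)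
  | imp _ _ ih₁ ih₂ =>
    exact fun h _ _ _ _ h₁ h₂ h₃ => imp_congr (ih₁ h.1 h₁ h₂ h₃) (ih₂ h.2 h₁ h₂ h₃)
  | all A _ ih =>
    exact fun h _ _ _ _ h₁ h₂ h₃ => forall_congr' fun a => forall_congr' fun a' =>
      forall_congr' fun ha => ih h ⟨h₁, A.rel_left ha⟩ ⟨h₂, A.rel_right ha⟩ ⟨h₃, ha⟩
  | ex A _ ih =>
    exact fun h _ _ _ _ h₁ h₂ h₃ => exists_congr fun a => exists_congr fun a' =>
      and_congr_right fun ha => ih h ⟨h₁, A.rel_left ha⟩ ⟨h₂, A.rel_right ha⟩ ⟨h₃, ha⟩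

theorem RenDen.subDen {Γ' Γ : Ctx} {ρ : ℕ → ℕ} {r : Γ'.env → Γ.env} (h : RenDen Γ' Γ ρ r) :
    SubDen Γ' Γ (fun i => .var (ρ i)) r := fun i A p hp => .var (h i A p hp)

theorem Fm.holds_shift {φ : Fm} {Γ Γ' : Ctx} {s : ℕ} {r : Γ'.env → Γ.env} (h : φ.Ok Γ)
    (hr : RenDen Γ' Γ (· + s) r) {η η' : Γ'.env} (hη : Γ'.rel η η') :
    (φ.shift s).holds Γ' η η' ↔ φ.holds Γ (r η) (r η') := by
  rw [Fm.shift, ← Fm.subst_var]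
  exact holds_subst h hr.subDen (fun _ _ => hr.rel) hη

/-- The schema variable receives a constant thunk, so the meaning of `φ(c)` depends on `c` only
through its denotation. -/
theorem Fm.at_den {φ : Fm} {Γ Γ' : Ctx} {C : CTy} {s : ℕ} {c : Comp} {r : Γ'.env → Γ.env}
    {d : Γ'.env → C.sem} (h : φ.Ok (Γ.cons (.fn .unit C))) (hr : RenDen Γ' Γ (· + s) r)
    (hd : CDen Γ' c C d) (hdr : ∀ η η', Γ'.rel η η' → C.rel (d η) (d η')) :
    (φ.at s c).Ok Γ' ∧ ∀ {η η'}, Γ'.rel η η' → ((φ.at s c).holds Γ' η η' ↔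
      φ.holds (Γ.cons (.fn .unit C)) (r η, fun _ => d η) (r η', fun _ => d η')) := by
  have hs : SubDen Γ' (Γ.cons (.fn .unit C))
      (fun | 0 => .lam (c.rename (· + 1)) | i + 1 => .var (i + s))
      (fun η => (r η, fun _ => d η)) := by
    intro i A p hp
    cases hp with
    | zero => exact .lam (hd.rename (RenDen.succ Γ' .unit))
    | succ hp => exact .var (hr _ _ _ hp)
  have hsr : ∀ η η', Γ'.rel η η' →
      (Γ.cons (.fn .unit C)).rel (r η, fun _ => d η) (r η', fun _ => d η') :=
    fun η η' hη => ⟨hr.rel hη, fun _ _ _ => hdr η η' hη⟩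
  exact ⟨h.subst hs hsr, fun hη => holds_subst h hs hsr hη⟩


/-! ## Semantic entailment -/

/-- `φ` and the hypotheses `Ψ` are semantically well-typed, and `Ψ` entails `φ`. -/
def EntailsOk (Γ : Ctx) (Ψ : List Fm) (φ : Fm) : Prop :=
  (∀ ψ ∈ Ψ, ψ.Ok Γ) ∧ φ.Ok Γ ∧
    ∀ η η', Γ.rel η η' → (∀ ψ ∈ Ψ, ψ.holds Γ η η') → φ.holds Γ η η'

/-- The semantic counterparts of the judgements. -/
def Judg.Sem : Judg → Prop
  | .vty A => A.Ok
  | .cty C => C.Ok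
  | .sig _ => True
  | .ctx Γ => ∀ i A, Γ.get? i = some A → A.Ok
  | .tctx _ _ => True
  | .tmpl Γ _ Z T S => TOk S Z Γ T
  | .theory E S => E.Ok S
  | .val Γ v A => VOk Γ v A ∧ A.Ok
  | .comp Γ c C => COk Γ c C ∧ C.Ok
  | .clauses Γ h S D => ClausesOk Γ h S D
  | .respects Γ h E S D => RespectsOk Γ h E S D
  | .fm Γ φ => φ.Ok Γ
  | .hyps Γ Ψ => ∀ ψ ∈ Ψ, ψ.Ok Γ
  | .entails Γ Ψ φ => EntailsOk Γ Ψ φ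

variable {Γ : Ctx} {Ψ : List Fm}

theorem EntailsOk.veq {v w : Val} {A : VTy} (hΨ : ∀ ψ ∈ Ψ, ψ.Ok Γ) (hv : VOk Γ v A)
    (hw : VOk Γ w A)
    (h : ∀ d d', VDen Γ v A d → VDen Γ w A d' → ∀ η η', Γ.rel η η' →
      (∀ ψ ∈ Ψ, ψ.holds Γ η η') → A.rel (d η) (d' η')) : EntailsOk Γ Ψ (.veq v w A) := by
  obtain ⟨d, hd, -⟩ := id hv
  obtain ⟨d', hd', -⟩ := id hw
  exact ⟨hΨ, ⟨hv, hw⟩, fun η η' hη hψ => ⟨d, d', hd, hd', h d d' hd hd' η η' hη hψ⟩⟩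

theorem EntailsOk.ceq {c c' : Comp} {C : CTy} (hΨ : ∀ ψ ∈ Ψ, ψ.Ok Γ) (hc : COk Γ c C)
    (hc' : COk Γ c' C)
    (h : ∀ d d', CDen Γ c C d → CDen Γ c' C d' → ∀ η η', Γ.rel η η' →
      (∀ ψ ∈ Ψ, ψ.holds Γ η η') → C.rel (d η) (d' η')) : EntailsOk Γ Ψ (.ceq c c' C) := by
  obtain ⟨d, hd, -⟩ := id hc
  obtain ⟨d', hd', -⟩ := id hc'
  exact ⟨hΨ, ⟨hc, hc'⟩, fun η η' hη hψ => ⟨d, d', hd, hd', h d d' hd hd' η η' hη hψ⟩⟩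

theorem EntailsOk.veq_elim {v w : Val} {A : VTy} (h : EntailsOk Γ Ψ (.veq v w A)) :
    ∃ d d', VDen Γ v A d ∧ VDen Γ w A d' ∧ (∀ η η', Γ.rel η η' → A.rel (d η) (d η')) ∧
      (∀ η η', Γ.rel η η' → A.rel (d' η) (d' η')) ∧
      ∀ η η', Γ.rel η η' → (∀ ψ ∈ Ψ, ψ.holds Γ η η') → A.rel (d η) (d' η') := by
  obtain ⟨-, ⟨⟨d, hd, hr⟩, d', hd', hr'⟩, h⟩ := h
  exact ⟨d, d', hd, hd', hr, hr', fun η η' hη hψ => (Fm.holds_veq hd hd' _ _).1 (h η η' hη hψ)⟩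

theorem EntailsOk.ceq_elim {c c' : Comp} {C : CTy} (h : EntailsOk Γ Ψ (.ceq c c' C)) :
    ∃ d d', CDen Γ c C d ∧ CDen Γ c' C d' ∧ (∀ η η', Γ.rel η η' → C.rel (d η) (d η')) ∧
      (∀ η η', Γ.rel η η' → C.rel (d' η) (d' η')) ∧
      ∀ η η', Γ.rel η η' → (∀ ψ ∈ Ψ, ψ.holds Γ η η') → C.rel (d η) (d' η') := by
  obtain ⟨-, ⟨⟨d, hd, hr⟩, d', hd', hr'⟩, h⟩ := h
  exact ⟨d, d', hd, hd', hr, hr', fun η η' hη hψ => (Fm.holds_ceq hd hd' _ _).1 (h η η' hη hψ)⟩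

/-- Equations between terms with equal denotations are semantically valid. -/
theorem EntailsOk.ceq_of_den {c c' : Comp} {C : CTy} {d : Γ.env → C.sem}
    (hΨ : ∀ ψ ∈ Ψ, ψ.Ok Γ) (hd : CDen Γ c C d) (hd' : CDen Γ c' C d)
    (hr : ∀ η η', Γ.rel η η' → C.rel (d η) (d η')) : EntailsOk Γ Ψ (.ceq c c' C) :=
  ⟨hΨ, ⟨⟨d, hd, hr⟩, d, hd', hr⟩, fun η η' hη _ => ⟨d, d, hd, hd', hr η η' hη⟩⟩

theorem EntailsOk.veq_of_den {v w : Val} {A : VTy} {d : Γ.env → A.sem}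
    (hΨ : ∀ ψ ∈ Ψ, ψ.Ok Γ) (hd : VDen Γ v A d) (hd' : VDen Γ w A d)
    (hr : ∀ η η', Γ.rel η η' → A.rel (d η) (d η')) : EntailsOk Γ Ψ (.veq v w A) :=
  ⟨hΨ, ⟨⟨d, hd, hr⟩, d, hd', hr⟩, fun η η' hη _ => ⟨d, d, hd, hd', hr η η' hη⟩⟩

theorem holds_shiftHyps {Γ' : Ctx} {s : ℕ} {r : Γ'.env → Γ.env} (hΨ : ∀ ψ ∈ Ψ, ψ.Ok Γ)
    (hr : RenDen Γ' Γ (· + s) r) {η η' : Γ'.env} (hη : Γ'.rel η η')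
    (h : ∀ ψ ∈ Ψ, ψ.holds Γ (r η) (r η')) : ∀ ψ ∈ shiftHyps s Ψ, ψ.holds Γ' η η' := by
  intro ψ hψ
  obtain ⟨ψ, hψ', rfl⟩ := List.mem_map.1 hψ
  exact (Fm.holds_shift (hΨ ψ hψ') hr hη).2 (h ψ hψ')

theorem EntailsOk.under {A : VTy} {φ : Fm} (hΨ : ∀ ψ ∈ Ψ, ψ.Ok Γ)
    (h : EntailsOk (Γ.cons A) (shiftHyps 1 Ψ) φ) {η η' : Γ.env} (hη : Γ.rel η η')
    (hψ : ∀ ψ ∈ Ψ, ψ.holds Γ η η') (a a' : A.sem) (ha : A.rel a a') :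
    φ.holds (Γ.cons A) (η, a) (η', a') :=
  h.2.2 (η, a) (η', a') ⟨hη, ha⟩
    (holds_shiftHyps hΨ (Γ' := Γ.cons A) (RenDen.succ Γ A) ⟨hη, ha⟩ hψ)

theorem RenDen.succ₂ (Γ : Ctx) (A B : VTy) :
    RenDen ((Γ.cons A).cons B) Γ (· + 2) (fun η => η.1.1) :=
  (RenDen.succ Γ A).comp_succ B

-- Soundness of substitution, replacement, handler congruence, induction and inheritance

theorem entails_subst {Γ' : Ctx} {φ : Fm} {σ : ℕ → Val} (hφ : φ.Ok Γ)
    (hσ : ∀ i A, Γ.get? i = some A → VOk Γ' (σ i) A) (h : EntailsOk Γ Ψ φ) :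
    EntailsOk Γ' (Ψ.map fun ψ => ψ.subst σ) (φ.subst σ) := by
  obtain ⟨s, hs, hr⟩ := exists_subDen Γ' Γ hσ
  obtain ⟨hΨ, -, h⟩ := h
  refine ⟨?_, hφ.subst hs hr, fun η η' hη hψ => ?_⟩
  · intro ψ hψ
    obtain ⟨ψ, hψ', rfl⟩ := List.mem_map.1 hψ
    exact (hΨ ψ hψ').subst hs hr
  · refine (Fm.holds_subst hφ hs hr hη).2 (h _ _ (hr _ _ hη) fun ψ hψ' => ?_)
    exact (Fm.holds_subst (hΨ ψ hψ') hs hr hη).1 (hψ _ (List.mem_map_of_mem hψ'))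

theorem VOk.sub1 {A : VTy} {v : Val} (hv : VOk Γ v A) :
    ∃ d, VDen Γ v A d ∧ SubDen Γ (Γ.cons A) (sub1 v) (fun η => (η, d η)) ∧
      (∀ η η', Γ.rel η η' → A.rel (d η) (d η')) ∧
      ∀ η η', Γ.rel η η' → (Γ.cons A).rel (η, d η) (η', d η') :=
  let ⟨d, hd, hr⟩ := hv
  ⟨d, hd, .sub1 hd, hr, fun _ _ hη => ⟨hη, hr _ _ hη⟩⟩

/-- Extending an environment by `v` or by `w` gives related environments, and formulae are invariant
under such a change. -/
theorem entails_replace {A : VTy} {φ : Fm} {v w : Val} (hφ : φ.Ok (Γ.cons A)) (hv : VOk Γ v A)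
    (hw : VOk Γ w A) (h : EntailsOk Γ Ψ (.veq v w A)) (h' : EntailsOk Γ Ψ (φ.subst (sub1 v))) :
    EntailsOk Γ Ψ (φ.subst (sub1 w)) := by
  obtain ⟨d, hd, hs, hr, hr'⟩ := hv.sub1
  obtain ⟨e, he, ht, hq, hq'⟩ := hw.sub1
  refine ⟨h.1, hφ.subst ht hq', fun η η' hη hψ => ?_⟩
  have hvw := (Fm.holds_veq hd he _ _).1 (h.2.2 η η' hη hψ)
  refine (Fm.holds_subst hφ ht hq' hη).2 ((Fm.holds_congr hφ ?_ ?_ ?_).1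
    ((Fm.holds_subst hφ hs hr' hη).1 (h'.2.2 η η' hη hψ)))
  -- The hypothesis compares `v` at `η` with `w` at `η'`; preservation by `w` brings the latter back
  -- to `η`.
  · exact ⟨Γ.rel_left hη, A.rel_trans hvw (hq _ _ (Γ.rel_symm hη))⟩
  · exact ⟨Γ.rel_right hη, A.rel_trans (hr _ _ (Γ.rel_symm hη)) hvw⟩
  · exact ⟨hη, hr _ _ hη⟩

/-- Each handler separately preserves `∼`, by its typing. The premises only say that the two agree
on returns and clauses. In the induction, symmetry, transitivity and equations are therefore
absorbed by the preservation property of a single handler. -/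
theorem entails_congr_handler {A : VTy} {S : Sig} {E : Theory} {D : CTy} {cr cr' : Comp}
    {h h' : Clauses} (hΨ : ∀ ψ ∈ Ψ, ψ.Ok Γ) (hE : E.Ok S)
    (hv : VOk Γ (.handler cr h) (.handler (cty A S E) D))
    (hv' : VOk Γ (.handler cr' h') (.handler (cty A S E) D))
    (hcr : EntailsOk (Γ.cons A) (shiftHyps 1 Ψ) (.ceq cr cr' D))
    (hh : ∀ i j j', h.name j = S.name i → h'.name j' = S.name i →
      EntailsOk ((Γ.cons (S.par i)).cons (.fn (S.res i) D)) (shiftHyps 2 Ψ)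
        (.ceq (h.body j) (h'.body j') D)) :
    EntailsOk Γ Ψ (.veq (.handler cr h) (.handler cr' h') (.handler (cty A S E) D)) := by
  refine .veq hΨ hv hv' fun d d' hd hd' η η' hη hψ => ?_
  have hr := hv.den hd
  have hr' := hv'.den hd'
  obtain ⟨g, H, hg, hH, rfl⟩ := VDen.handler_inv hd
  obtain ⟨g', H', hg', hH', rfl⟩ := VDen.handler_inv hd'
  have hgg : ∀ a a', A.rel a a' → D.rel (g (η, a)) (g' (η', a')) := fun a a' ha =>
    (Fm.holds_ceq hg hg' _ _).1 (hcr.under hΨ hη hψ a a' ha)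
  have hHH : Interp.Rel D.rel (H η) (H' η') := by
    cases hH with
    | mk e he hb =>
      cases hH' with
      | mk e' he' hb' =>
        intro i a a' ha κ κ' hκ
        have hx : ((Γ.cons (S.par i)).cons (.fn (S.res i) D)).rel ((η, a), κ) ((η', a'), κ') :=
          ⟨⟨hη, ha⟩, hκ⟩
        exact (Fm.holds_ceq (hb i) (hb' i) _ _).1 ((hh i _ _ (he i) (he' i)).2.2 _ _ hx
          (holds_shiftHyps hΨ (RenDen.succ₂ Γ _ _) hx hψ))
  intro t t' ht
  have hl := hr η η (Γ.rel_left hη)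
  have hl' := hr' η' η' (Γ.rel_right hη)
  change ∀ t t', (cty A S E).rel t t' →
    D.rel (lift (H η) (fun a => g (η, a)) t) (lift (H η) (fun a => g (η, a)) t') at hl
  change ∀ t t', (cty A S E).rel t t' →
    D.rel (lift (H' η') (fun a => g' (η', a)) t) (lift (H' η') (fun a => g' (η', a)) t') at hl'
  change TreeRel S E _ _ _ _ _ _ _ at ht
  change D.rel (lift (H η) (fun a => g (η, a)) t) (lift (H' η') (fun a => g' (η', a)) t')
  induction ht with
  | @symm t t' ht ih =>
    exact D.rel_trans (hl t' t (.symm ht)) (D.rel_trans ih (hl' t' t (.symm ht)))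
  | trans _ ht ih _ => exact D.rel_trans ih (hl' _ _ ht)
  | ret ha => exact hgg _ _ ha
  | op ha _ ih => exact hHH _ _ _ ha _ _ ih
  | @eqn e t₁ t₂ a a' f f' h₁ h₂ ha hf ih =>
    obtain ⟨t, ht, hp⟩ := (hE (E.eqn e) ⟨e, rfl⟩).1
    obtain rfl := ht.unique h₁
    have hf' : ∀ j b b', ((E.eqn e).tvars j).rel b b' →
        (cty A S E).rel (f' j b) (f' j b') := fun j b b' hb =>
      (cty A S E).rel_trans (TreeRel.symm (hf j b b (((E.eqn e).tvars j).rel_left hb)))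
        (hf j b b' hb)
    -- First change the handler while keeping the left template, by parametricity; then change the
    -- template under the second handler.
    refine D.rel_trans ?_ (hl' _ _ (TreeRel.eqn h₁ h₂ ((E.eqn e).vars.rel_right ha) hf'))
    rw [h₁.lift, h₁.lift]
    exact hp _ _ _ _ hHH _ _ ha _ _ ih

/-- Induction on the derivation of `t ∼ t'`, not on a tree: the property concerns related pairs and
must survive the equations of `E`. -/
theorem entails_induction {A : VTy} {S : Sig} {E : Theory} {c : Comp} {φ : Fm}
    (hΨ : ∀ ψ ∈ Ψ, ψ.Ok Γ) (hE : E.Ok S) (hc : COk Γ c (cty A S E))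
    (hφ : φ.Ok (Γ.cons (.fn .unit (cty A S E))))
    (hret : EntailsOk (Γ.cons A) (shiftHyps 1 Ψ) (φ.at 1 (.ret (.var 0))))
    (hop : ∀ i : Fin S.n, EntailsOk ((Γ.cons (S.par i)).cons (.fn (S.res i) (cty A S E)))
      (.all (S.res i) (φ.at 3 (.app (.var 1) (.var 0))) :: shiftHyps 2 Ψ)
      (φ.at 2 (.op (S.name i) (.var 1) (.app (.var 1) (.var 0))))) :
    EntailsOk Γ Ψ (φ.at 0 c) := by
  obtain ⟨d, hd, hr⟩ := id hc
  have hat := Fm.at_den (s := 0) (r := id) hφ (fun _ _ _ hp => hp) hd hr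
  refine ⟨hΨ, hat.1, fun η η' hη hψ => (hat.2 hη).2 ?_⟩
  set C := cty A S E with hC
  -- Relatedness is kept inside `P` so that `P` can serve as the relation for parametricity and the
  -- continuations in the operation case are related functions.
  let P : C.sem → C.sem → Prop := fun t t' =>
    C.rel t t' ∧ φ.holds (Γ.cons (.fn .unit C)) (η, fun _ => t) (η', fun _ => t')
  have congr : ∀ {t t' u u' : C.sem}, C.rel t u → C.rel t' u' → C.rel t t' →
      φ.holds (Γ.cons (.fn .unit C)) (η, fun _ => t) (η', fun _ => t') →
      φ.holds (Γ.cons (.fn .unit C)) (η, fun _ => u) (η', fun _ => u') :=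
    fun {t t' u u'} h₁ h₂ h₃ => (Fm.holds_congr hφ (Γ := Γ.cons (.fn .unit C))
      (η₁ := (η, fun _ => t)) (η₁' := (η', fun _ => t')) (η₂ := (η, fun _ => u))
      (η₂' := (η', fun _ => u')) ⟨Γ.rel_left hη, fun _ _ _ => h₁⟩
      ⟨Γ.rel_right hη, fun _ _ _ => h₂⟩ ⟨hη, fun _ _ _ => h₃⟩).1
  have hPret : ∀ a a', A.rel a a' → P (Tree.ret a) (Tree.ret a') := by
    intro a a' ha
    refine ⟨TreeRel.ret ha, ?_⟩
    have hd : CDen (Γ.cons A) (.ret (.var 0)) C (fun x => Tree.ret x.2) := .ret (.var .zero)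
    exact ((Fm.at_den (Γ' := Γ.cons A) hφ (RenDen.succ Γ A) hd
      fun _ _ h => TreeRel.ret h.2).2 (η := (η, a)) (η' := (η', a')) ⟨hη, ha⟩).1
      (hret.under hΨ hη hψ a a' ha)
  have hPop : Interp.Rel P (freeInterp S A.sem) (freeInterp S A.sem) := by
    intro i a a' ha κ κ' hκ
    have hκr : (VTy.fn (S.res i) C).rel κ κ' := fun b b' hb => (hκ b b' hb).1
    refine ⟨TreeRel.op ha hκr, ?_⟩
    have hx : ((Γ.cons (S.par i)).cons (.fn (S.res i) C)).rel ((η, a), κ) ((η', a'), κ') :=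
      ⟨⟨hη, ha⟩, hκr⟩
    have hd₁ : CDen (((Γ.cons (S.par i)).cons (.fn (S.res i) C)).cons (S.res i))
        (.app (.var 1) (.var 0)) C (fun x => x.1.2 x.2) :=
      .app (.var (.succ .zero)) (.var .zero)
    have hd₂ : CDen ((Γ.cons (S.par i)).cons (.fn (S.res i) C))
        (.op (S.name i) (.var 1) (.app (.var 1) (.var 0))) C
        (fun x => Tree.op i x.1.2 (fun b => x.2 b)) :=
      .op (.var (.succ .zero)) hd₁
    refine ((Fm.at_den (Γ' := (Γ.cons (S.par i)).cons (.fn (S.res i) C)) hφ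
      (RenDen.succ₂ Γ _ _) hd₂ fun _ _ h => TreeRel.op h.1.2 h.2).2 hx).1 ?_
    refine (hop i).2.2 _ _ hx fun ψ hψ' => ?_
    rcases List.mem_cons.1 hψ' with rfl | hψ'
    · intro b b' hb
      exact ((Fm.at_den (Γ' := ((Γ.cons (S.par i)).cons (.fn (S.res i) C)).cons (S.res i)) hφ
        ((RenDen.succ₂ Γ _ _).comp_succ _) hd₁ fun _ _ h => h.1.2 _ _ h.2).2
        (η := (((η, a), κ), b)) (η' := (((η', a'), κ'), b')) ⟨hx, hb⟩).2 (hκ b b' hb).2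
    · exact holds_shiftHyps hΨ (RenDen.succ₂ Γ _ _) hx hψ ψ hψ'
  have main : ∀ t t' : C.sem, C.rel t t' → P t t' := by
    intro t t' ht
    change TreeRel S E _ _ _ _ _ _ _ at ht
    induction ht with
    | @symm t t' ht ih =>
      exact ⟨TreeRel.symm ht, congr ht (TreeRel.symm ht) ht ih.2⟩
    | @trans t t' t'' ht ht' ih _ =>
      exact ⟨TreeRel.trans ht ht', congr (C.rel_left ht) ht' ht ih.2⟩
    | ret ha => exact hPret _ _ ha
    | op ha _ ih => exact hPop _ _ _ ha _ _ ih
    | @eqn e t₁ t₂ a a' f f' h₁ h₂ ha hf ih =>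
      obtain ⟨t, ht, hp⟩ := (hE (E.eqn e) ⟨e, rfl⟩).1
      obtain rfl := ht.unique h₁
      -- Parametricity of the left template at `P` compares its two instances; invariance then
      -- replaces the second instance by that of the right template.
      have key := hp _ P _ _ hPop _ _ ha _ _ ih
      have hf' : ∀ j b b', ((E.eqn e).tvars j).rel b b' → C.rel (f' j b) (f' j b') :=
        fun j b b' hb => C.rel_trans
          (TreeRel.symm (hf j b b (((E.eqn e).tvars j).rel_left hb))) (hf j b b' hb)
      have heq : C.rel _ _ := TreeRel.eqn h₁ h₂ ((E.eqn e).vars.rel_right ha) hf'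
      exact ⟨C.rel_trans key.1 heq, congr (C.rel_left key.1) heq key.1 key.2⟩
  exact (main _ _ (hr η η' hη)).2

/-- Both sides denote their templates in the free interpretation at the substituted arguments, so
the instance is a generating equation of `∼`. -/
theorem entails_inherit {A : VTy} {S : Sig} {E : Theory} {e : Equation} {v f : ℕ → Val}
    (hΨ : ∀ ψ ∈ Ψ, ψ.Ok Γ) (hE : E.Ok S) (he : e ∈ E)
    (hv : ∀ i B, e.vars.get? i = some B → VOk Γ (v i) B)
    (hf : ∀ j : Fin e.k, VOk Γ (f j) (.fn (e.tvars j) (cty A S E))) :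
    EntailsOk Γ Ψ
      (.ceq
        ((e.lhs.inst fun j => (f j).rename (· + e.vars.length)).subst (subBlock e.vars.length v))
        ((e.rhs.inst fun j => (f j).rename (· + e.vars.length)).subst (subBlock e.vars.length v))
        (cty A S E)) := by
  obtain ⟨s, hs, hsr⟩ := exists_subDen Γ e.vars hv
  choose F hF hFr using hf
  obtain ⟨l, r, pair, hl, hr, hpl, hpr, -, hlook⟩ := Γ.append_den e.vars
  have hsub : SubDen Γ (Γ.append e.vars) (subBlock e.vars.length v) (fun η => pair η (s η)) := by
    intro i B p hp
    rcases hlook i B p hp with ⟨hi, q, hq, rfl⟩ | ⟨hi, q, hq, rfl⟩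
    · simpa only [subBlock, if_pos hi, hpr] using hs _ _ _ hq
    · simpa only [subBlock, if_neg (Nat.not_lt.2 hi), hpl] using VDen.var hq
  have inst : ∀ {T t}, TDen S e.tvars e.vars T t →
      CDen Γ ((T.inst fun j => (f j).rename (· + e.vars.length)).subst
        (subBlock e.vars.length v)) (cty A S E)
        (fun η => t _ (freeInterp S A.sem) (s η) (fun j => F j η)) := by
    intro T t hT
    have := (hT.inst (f := fun j => (f j).rename (· + e.vars.length)) hr
      fun j => (hF j).rename hl).subst hsub
    simpa only [hpl, hpr] using this
  obtain ⟨⟨t₁, h₁, hp₁⟩, t₂, h₂, hp₂⟩ := hE e he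
  have ok : ∀ η η', Γ.rel η η' → ∀ j b b', (e.tvars j).rel b b' →
      (cty A S E).rel (F j η b) (F j η' b') := fun η η' hη j => hFr j η η' hη
  refine .ceq hΨ ⟨_, inst h₁, fun η η' hη => ?_⟩ ⟨_, inst h₂, fun η η' hη => ?_⟩
    fun d d' hd hd' η η' hη _ => ?_
  · exact hp₁ _ _ _ _ (freeInterp_rel A S E) _ _ (hsr _ _ hη) _ _ (ok _ _ hη)
  · exact hp₂ _ _ _ _ (freeInterp_rel A S E) _ _ (hsr _ _ hη) _ _ (ok _ _ hη)
  · obtain rfl := hd.unique (inst h₁)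
    obtain rfl := hd'.unique (inst h₂)
    exact freeInterp_respected A S E he _ _ h₁ h₂ _ _ (hsr _ _ hη) _ _ (ok _ _ hη)

/-- The entailment is evaluated at the environments assembled from `η`, the equation variables and
the functions. There the two sides denote the templates in the interpretation given by `h`. -/
theorem RespectsOk.insert {S : Sig} {D : CTy} {h : Clauses} {E E' : Theory} {e : Equation}
    (hE : RespectsOk Γ h E S D) (hE' : E'.Ok S) (hmem : ∀ e' : Equation, e' ∈ E' ↔ e' ∈ E ∨ e' = e)
    (hent : EntailsOk ((Γ.append e.vars).addFns D e.k e.tvars) []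
      (.ceq
        ((e.lhs.rename (· + e.k)).handleWith (h.rename (· + (e.vars.length + e.k)))
          (fun j => .var (e.k - 1 - j)))
        ((e.rhs.rename (· + e.k)).handleWith (h.rename (· + (e.vars.length + e.k)))
          (fun j => .var (e.k - 1 - j)))
        D)) :
    RespectsOk Γ h E' S D := by
  obtain ⟨-, H, hH, hHr, hHE⟩ := hE
  refine ⟨hE', H, hH, hHr, fun e' he' => ?_⟩
  rcases (hmem e').1 he' with he | rfl
  · exact hHE e' he
  obtain ⟨l, r, pair, hl, hr, hpl, hpr, hrel, -⟩ := Γ.append_den e'.vars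
  obtain ⟨l₂, pair₂, hl₂, hpl₂, hfn, hrel₂⟩ := (Γ.append e'.vars).addFns_den D e'.k e'.tvars
  choose fn hfn hpf using hfn
  intro η η' hη t₁ t₂ h₁ h₂ a a' ha f f' hf
  have hren : RenDen ((Γ.append e'.vars).addFns D e'.k e'.tvars) e'.vars (· + e'.k)
      (fun x => r (l₂ x)) := fun i A p hp => hl₂ _ _ _ (hr _ _ _ hp)
  have hren' : RenDen ((Γ.append e'.vars).addFns D e'.k e'.tvars) Γ
      (· + (e'.vars.length + e'.k)) (fun x => l (l₂ x)) := fun i A p hp => by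
    have := hl₂ _ _ _ (hl _ _ _ hp)
    simpa only [Nat.add_assoc] using this
  have hf₀ := fun j : Fin e'.k => VDen.var (hfn j)
  have key := (Fm.holds_ceq
    (h₁.handleWith (f := fun j => .var (e'.k - 1 - j)) hren (hH.rename hren') hf₀)
    (h₂.handleWith (f := fun j => .var (e'.k - 1 - j)) hren (hH.rename hren') hf₀) _ _).1
    (hent.2.2 _ _ (hrel₂ _ _ f f' (hrel _ _ _ _ hη ha) hf) fun _ h => nomatch h)
  simpa only [hpl₂, hpl, hpr, hpf] using key


-- Soundness of the congruence rules for conditionals and sequencing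

theorem entails_congr_ite {v v' : Val} {c₁ c₁' c₂ c₂' : Comp} {C : CTy}
    (h : EntailsOk Γ Ψ (.veq v v' .bool)) (h₁ : EntailsOk Γ Ψ (.ceq c₁ c₁' C))
    (h₂ : EntailsOk Γ Ψ (.ceq c₂ c₂' C)) :
    EntailsOk Γ Ψ (.ceq (.ite v c₁ c₂) (.ite v' c₁' c₂') C) := by
  obtain ⟨b, b', hb, hb', -, -, hr⟩ := h.veq_elim
  obtain ⟨d₁, d₁', hd₁, hd₁', -, -, hr₁⟩ := h₁.ceq_elim
  obtain ⟨d₂, d₂', hd₂, hd₂', -, -, hr₂⟩ := h₂.ceq_elim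
  refine .ceq h.1 (.ite h.2.1.1 h₁.2.1.1 h₂.2.1.1) (.ite h.2.1.2 h₁.2.1.2 h₂.2.1.2)
    fun d d' hd hd' η η' hη hψ => ?_
  obtain rfl := hd.unique (.ite hb hd₁ hd₂)
  obtain rfl := hd'.unique (.ite hb' hd₁' hd₂')
  have hbb : b η = b' η' := hr η η' hη hψ
  simp only [← hbb]
  cases b η
  · exact hr₂ η η' hη hψ
  · exact hr₁ η η' hη hψ

theorem entails_congr_bind {c₁ c₁' c₂ c₂' : Comp} {A B : VTy} {S : Sig} {E : Theory}
    (h₁ : EntailsOk Γ Ψ (.ceq c₁ c₁' (cty A S E)))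
    (h₂ : EntailsOk (Γ.cons A) (shiftHyps 1 Ψ) (.ceq c₂ c₂' (cty B S E))) :
    EntailsOk Γ Ψ (.ceq (.bind c₁ c₂) (.bind c₁' c₂') (cty B S E)) := by
  obtain ⟨d₁, d₁', hd₁, hd₁', -, -, hr₁⟩ := h₁.ceq_elim
  obtain ⟨d₂, d₂', hd₂, hd₂', hq₂, hq₂', -⟩ := h₂.ceq_elim
  refine .ceq h₁.1 (.bind h₁.2.1.1 h₂.2.1.1) (.bind h₁.2.1.2 h₂.2.1.2)
    fun d d' hd hd' η η' hη hψ => ?_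
  obtain rfl := hd.unique (.bind hd₁ hd₂)
  obtain rfl := hd'.unique (.bind hd₁' hd₂')
  have hg : ∀ a a', A.rel a a' → (cty B S E).rel (d₂ (η, a)) (d₂' (η', a')) := fun a a' ha =>
    (Fm.holds_ceq hd₂ hd₂' _ _).1 (h₂.under h₁.1 hη hψ a a' ha)
  have hg₁ : ∀ a a', A.rel a a' → (cty B S E).rel (d₂ (η, a)) (d₂ (η, a')) := fun a a' ha =>
    hq₂ _ _ ⟨Γ.rel_left hη, ha⟩
  have hg₂ : ∀ a a', A.rel a a' → (cty B S E).rel (d₂' (η', a)) (d₂' (η', a')) := fun a a' ha =>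
    hq₂' _ _ ⟨Γ.rel_right hη, ha⟩
  -- The two continuations become a family over `Bool` in which all indices are related. The
  -- diagonal cases come from preservation by each one, the mixed cases from the premise and its
  -- symmetric form.
  refine bind_rel (ι := Bool) (R := fun _ _ => True) (fun _ _ _ => trivial)
    (fun _ _ _ => trivial)
    (g := fun i => bif i then fun a => d₂ (η, a) else fun a => d₂' (η', a)) ?_
    (hr₁ η η' hη hψ) true false trivial
  rintro (_ | _) (_ | _) - a a' ha
  · exact hg₂ a a' ha
  · exact (cty B S E).rel_symm (hg a' a (A.rel_symm ha))
  · exact hg a a' ha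
  · exact hg₁ a a' ha

-- Soundness of computation and extensionality rules

theorem entails_eta_bool {v : Val} {c : Comp} {C : CTy} (hΨ : ∀ ψ ∈ Ψ, ψ.Ok Γ)
    (hv : VOk Γ v .bool) (hc : COk (Γ.cons .bool) c C) :
    EntailsOk Γ Ψ
      (.ceq (c.subst (sub1 v)) (.ite v (c.subst (sub1 .tt)) (c.subst (sub1 .ff))) C) := by
  obtain ⟨b, hb, hbr⟩ := hv
  obtain ⟨d, hd, hr⟩ := hc
  refine .ceq_of_den hΨ (hd.subst (.sub1 hb)) ?_ fun η η' hη => hr _ _ ⟨hη, hbr η η' hη⟩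
  convert CDen.ite hb (hd.subst (.sub1 .tt)) (hd.subst (.sub1 .ff)) using 1
  funext η
  cases b η <;> rfl

theorem lift_freeInterp_ret {S : Sig} {X : Type} (t : S.Free X) :
    lift (freeInterp S X) Tree.ret t = t := by
  induction t with
  | ret x => rfl
  | op i a κ ih => exact congrArg (freeInterp S X i a) (funext ih)

theorem entails_beta_bind_op {A B : VTy} {S : Sig} {E : Theory} {i : Fin S.n} {v : Val}
    {c₁ c₂ : Comp} (hΨ : ∀ ψ ∈ Ψ, ψ.Ok Γ) (hv : VOk Γ v (S.par i))
    (h₁ : COk (Γ.cons (S.res i)) c₁ (cty A S E)) (h₂ : COk (Γ.cons A) c₂ (cty B S E)) :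
    EntailsOk Γ Ψ
      (.ceq (.bind (.op (S.name i) v c₁) c₂)
        (.op (S.name i) v (.bind c₁ (c₂.rename (liftRen (· + 1))))) (cty B S E)) := by
  obtain ⟨d, hd, hdr⟩ := COk.bind (.op hv h₁) h₂
  obtain ⟨a, ha, -⟩ := hv
  obtain ⟨d₁, hd₁, -⟩ := h₁
  obtain ⟨d₂, hd₂, -⟩ := h₂
  refine .ceq_of_den hΨ hd ?_ hdr
  obtain rfl := hd.unique (.bind (.op ha hd₁) hd₂)
  exact .op ha (.bind hd₁ (hd₂.rename ((RenDen.succ Γ (S.res i)).lift A)))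

/-- Handlers are deep: `lift` applies the clause to the recursively lifted continuation, which is
exactly the denotation of the abstraction substituted for `k`. -/
theorem entails_beta_handle_op {A : VTy} {S : Sig} {E : Theory} {D : CTy} {cr : Comp}
    {h : Clauses} {i : Fin S.n} {j : Fin h.n} {v : Val} {c : Comp} (hΨ : ∀ ψ ∈ Ψ, ψ.Ok Γ)
    (hh : VOk Γ (.handler cr h) (.handler (cty A S E) D)) (hv : VOk Γ v (S.par i))
    (hc : COk (Γ.cons (S.res i)) c (cty A S E)) (hj : h.name j = S.name i) :
    EntailsOk Γ Ψ
      (.ceq (.handle (.handler cr h) (.op (S.name i) v c))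
        ((h.body j).subst
          (sub2 v (.lam (.handle ((Val.handler cr h).rename (· + 1)) c)))) D) := by
  obtain ⟨d, hd, hdr⟩ := COk.handle hh (.op hv hc)
  obtain ⟨H, hH, -⟩ := hh
  obtain ⟨a, ha, -⟩ := hv
  obtain ⟨κ, hκ, -⟩ := hc
  refine .ceq_of_den hΨ hd ?_ hdr
  obtain rfl := hd.unique (.handle hH (.op ha hκ))
  have hlam := VDen.lam (.handle (hH.rename (RenDen.succ Γ (S.res i))) hκ)
  obtain ⟨g, I, hg, hI, rfl⟩ := hH.handler_inv
  cases hI with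
  | mk e he hb =>
    obtain rfl : e i = j := h.name.injective ((he i).trans hj.symm)
    exact (hb i).subst (.sub2 ha hlam)

theorem entails_beta_handle_ret {A : VTy} {S : Sig} {E : Theory} {D : CTy} {cr : Comp}
    {h : Clauses} {v : Val} (hΨ : ∀ ψ ∈ Ψ, ψ.Ok Γ)
    (hh : VOk Γ (.handler cr h) (.handler (cty A S E) D)) (hv : VOk Γ v A) :
    EntailsOk Γ Ψ (.ceq (.handle (.handler cr h) (.ret v)) (cr.subst (sub1 v)) D) := by
  obtain ⟨d, hd, hdr⟩ := COk.handle hh (.ret S E hv)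
  obtain ⟨H, hH, -⟩ := hh
  obtain ⟨a, ha, -⟩ := hv
  refine .ceq_of_den hΨ hd ?_ hdr
  obtain rfl := hd.unique (.handle hH (.ret ha))
  obtain ⟨g, I, hg, hI, rfl⟩ := hH.handler_inv
  exact hg.subst (.sub1 ha)

/-- Derivable judgements are semantically valid. -/
theorem Provable.sem {J : Judg} (h : Provable J) : J.Sem := by
  induction h with
  | vty_unit => trivial
  | vty_bool => trivial
  | vty_fn _ _ _ ih => exact ih
  | vty_handler _ _ ih₁ ih₂ => exact ⟨ih₁, ih₂⟩
  | cty_mk _ _ _ _ _ ih => exact ih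
  | sig_mk => trivial
  | ctx_nil => exact fun _ _ h => nomatch h
  | ctx_cons _ _ ih₁ ih₂ =>
    intro i A h
    cases i with
    | zero =>
      obtain rfl := Option.some.inj h
      exact ih₂
    | succ i => exact ih₁ i A h
  | tctx_mk => trivial
  | tmpl_app _ _ _ _ _ ih => exact .app ih.1
  | tmpl_ite _ _ _ ih ih₁ ih₂ => exact .ite ih.1 ih₁ ih₂
  | tmpl_op _ _ ih ih' => exact .op ih.1 ih'
  | theory_mk _ _ _ _ _ _ _ _ ih₁ ih₂ => exact fun e he => ⟨ih₁ e he, ih₂ e he⟩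
  -- Variables obtain well-formedness of their types from the context, so `VTy.Ok` need not record
  -- it for argument types.
  | val_var _ h ih => exact ⟨.lookup h, ih _ _ h⟩
  | val_unit => exact ⟨.unit _, trivial⟩
  | val_tt => exact ⟨.tt _, trivial⟩
  | val_ff => exact ⟨.ff _, trivial⟩
  | val_lam _ ih => exact ⟨.lam ih.1, ih.2⟩
  | val_handler _ _ ih₁ ih₂ => exact ⟨.handler ih₁.1 ih₂, ih₂.1, ih₁.2⟩
  | comp_ite _ _ _ ih ih₁ ih₂ => exact ⟨.ite ih.1 ih₁.1 ih₂.1, ih₁.2⟩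
  | comp_app _ _ ih₁ ih₂ => exact ⟨.app ih₁.1 ih₂.1, ih₁.2⟩
  | comp_ret _ _ ih₁ ih₂ => exact ⟨.ret _ _ ih₁.1, ih₂⟩
  | comp_op _ _ ih₁ ih₂ => exact ⟨.op ih₁.1 ih₂.1, ih₂.2⟩
  | comp_bind _ _ ih₁ ih₂ => exact ⟨.bind ih₁.1 ih₂.1, ih₂.2⟩
  | comp_handle _ _ ih₁ ih₂ => exact ⟨.handle ih₁.1 ih₂.1, ih₁.2.2⟩
  | clauses_mk e _ _ _ he _ _ _ _ ih => exact .intro e he fun i => (ih i).1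
  | respects_empty _ _ h ih₁ ih₂ =>
    obtain ⟨H, hH, hr⟩ := ih₁
    exact ⟨ih₂, H, hH, hr, fun e he => (h e he).elim⟩
  | respects_insert _ _ h _ ih₁ ih₂ ih₃ => exact RespectsOk.insert ih₁ ih₂ h ih₃
  | fm_veq _ _ ih₁ ih₂ => exact ⟨ih₁.1, ih₂.1⟩
  | fm_ceq _ _ ih₁ ih₂ => exact ⟨ih₁.1, ih₂.1⟩
  | fm_top => trivial
  | fm_bot => trivial
  | fm_and _ _ ih₁ ih₂ => exact ⟨ih₁, ih₂⟩
  | fm_or _ _ ih₁ ih₂ => exact ⟨ih₁, ih₂⟩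
  | fm_imp _ _ ih₁ ih₂ => exact ⟨ih₁, ih₂⟩
  | fm_all _ ih => exact ih
  | fm_ex _ ih => exact ih
  | hyps_mk _ _ _ ih => exact ih
  | hyp _ h ih => exact ⟨ih, ih _ h, fun _ _ _ hψ => hψ _ h⟩
  | weaken _ h _ ih₁ ih₂ =>
    exact ⟨ih₂, ih₁.2.1, fun η η' hη hψ => ih₁.2.2 η η' hη fun ψ h' => hψ ψ (h ψ h')⟩
  | subst _ _ _ _ _ _ ih₁ _ ih₂ ih₃ => exact entails_subst ih₁ (fun i A h => (ih₂ i A h).1) ih₃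
  | replace _ _ _ _ _ ih₁ ih₂ ih₃ ih₄ ih₅ => exact entails_replace ih₁ ih₂.1 ih₃.1 ih₄ ih₅
  | veq_refl _ _ ih₁ ih₂ =>
    obtain ⟨⟨d, hd, hr⟩, -⟩ := ih₂
    exact .veq_of_den ih₁ hd hd hr
  | @veq_symm _ _ _ _ A _ ih =>
    obtain ⟨d, d', hd, hd', hr, hr', h⟩ := EntailsOk.veq_elim ih
    refine .veq ih.1 ih.2.1.2 ih.2.1.1 fun e' e he' he η η' hη hψ => ?_
    obtain rfl := hd.unique he
    obtain rfl := hd'.unique he'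
    -- Swapping the sides alone would also swap `η` and `η'`; preservation by both terms restores
    -- the order of the environments.
    exact A.rel_trans (hr' _ _ hη) (A.rel_trans (A.rel_symm (h _ _ hη hψ)) (hr _ _ hη))
  | @veq_trans Γ _ _ _ _ A _ _ ih₁ ih₂ =>
    obtain ⟨d₁, d₂, hd₁, hd₂, -, hr, h⟩ := EntailsOk.veq_elim ih₁
    obtain ⟨d₂', d₃, hd₂', hd₃, -, -, h'⟩ := EntailsOk.veq_elim ih₂
    obtain rfl := hd₂.unique hd₂'
    refine .veq ih₁.1 ih₁.2.1.1 ih₂.2.1.2 fun e e' he he' η η' hη hψ => ?_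
    obtain rfl := hd₁.unique he
    obtain rfl := hd₃.unique he'
    exact A.rel_trans (h _ _ hη hψ) (A.rel_trans (hr _ _ (Γ.rel_symm hη)) (h' _ _ hη hψ))
  | ceq_refl _ _ ih₁ ih₂ =>
    obtain ⟨⟨d, hd, hr⟩, -⟩ := ih₂
    exact .ceq_of_den ih₁ hd hd hr
  | @ceq_symm _ _ _ _ C _ ih =>
    obtain ⟨d, d', hd, hd', hr, hr', h⟩ := EntailsOk.ceq_elim ih
    refine .ceq ih.1 ih.2.1.2 ih.2.1.1 fun e' e he' he η η' hη hψ => ?_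
    obtain rfl := hd.unique he
    obtain rfl := hd'.unique he'
    exact C.rel_trans (hr' _ _ hη) (C.rel_trans (C.rel_symm (h _ _ hη hψ)) (hr _ _ hη))
  | @ceq_trans Γ _ _ _ _ C _ _ ih₁ ih₂ =>
    obtain ⟨d₁, d₂, hd₁, hd₂, -, hr, h⟩ := EntailsOk.ceq_elim ih₁
    obtain ⟨d₂', d₃, hd₂', hd₃, -, -, h'⟩ := EntailsOk.ceq_elim ih₂
    obtain rfl := hd₂.unique hd₂'
    refine .ceq ih₁.1 ih₁.2.1.1 ih₂.2.1.2 fun e e' he he' η η' hη hψ => ?_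
    obtain rfl := hd₁.unique he
    obtain rfl := hd₃.unique he'
    exact C.rel_trans (h _ _ hη hψ) (C.rel_trans (hr _ _ (Γ.rel_symm hη)) (h' _ _ hη hψ))
  | congr_lam _ _ ih₁ ih₂ =>
    obtain ⟨d, d', hd, hd', -, -, h⟩ := EntailsOk.ceq_elim ih₂
    refine .veq ih₁ (.lam ih₂.2.1.1) (.lam ih₂.2.1.2) fun e e' he he' η η' hη hψ => ?_
    obtain rfl := he.unique (.lam hd)
    obtain rfl := he'.unique (.lam hd')
    exact fun a a' ha => (Fm.holds_ceq hd hd' _ _).1 (EntailsOk.under ih₁ ih₂ hη hψ a a' ha)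
  | congr_handler _ _ _ _ _ ih₁ ih₂ ih₃ ih₄ ih₅ =>
    exact entails_congr_handler ih₁ ih₂.2.1 ih₂.1 ih₃.1 ih₄ ih₅
  | congr_ite _ _ _ ih ih₁ ih₂ => exact entails_congr_ite ih ih₁ ih₂
  | congr_app _ _ ih₁ ih₂ =>
    obtain ⟨d₁, d₁', hd₁, hd₁', -, -, h₁⟩ := EntailsOk.veq_elim ih₁
    obtain ⟨d₂, d₂', hd₂, hd₂', -, -, h₂⟩ := EntailsOk.veq_elim ih₂
    refine .ceq ih₁.1 (.app ih₁.2.1.1 ih₂.2.1.1) (.app ih₁.2.1.2 ih₂.2.1.2)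
      fun e e' he he' η η' hη hψ => ?_
    obtain rfl := he.unique (.app hd₁ hd₂)
    obtain rfl := he'.unique (.app hd₁' hd₂')
    exact h₁ η η' hη hψ _ _ (h₂ η η' hη hψ)
  | @congr_ret _ _ _ _ _ S E _ _ _ ih =>
    obtain ⟨d, d', hd, hd', -, -, h⟩ := EntailsOk.veq_elim ih
    refine .ceq ih.1 (.ret S E ih.2.1.1) (.ret S E ih.2.1.2) fun e e' he he' η η' hη hψ => ?_
    obtain rfl := he.unique (.ret hd)
    obtain rfl := he'.unique (.ret hd')
    exact TreeRel.ret (h η η' hη hψ)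
  | congr_op _ _ ih₁ ih₂ =>
    obtain ⟨d₁, d₁', hd₁, hd₁', -, -, h₁⟩ := EntailsOk.veq_elim ih₁
    obtain ⟨d₂, d₂', hd₂, hd₂', -, -, -⟩ := EntailsOk.ceq_elim ih₂
    refine .ceq ih₁.1 (.op ih₁.2.1.1 ih₂.2.1.1) (.op ih₁.2.1.2 ih₂.2.1.2)
      fun e e' he he' η η' hη hψ => ?_
    obtain rfl := he.unique (.op hd₁ hd₂)
    obtain rfl := he'.unique (.op hd₁' hd₂')
    exact TreeRel.op (h₁ η η' hη hψ) fun b b' hb =>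
      (Fm.holds_ceq hd₂ hd₂' _ _).1 (EntailsOk.under ih₁.1 ih₂ hη hψ b b' hb)
  | congr_bind _ _ ih₁ ih₂ => exact entails_congr_bind ih₁ ih₂
  | congr_handle _ _ ih₁ ih₂ =>
    obtain ⟨d₁, d₁', hd₁, hd₁', -, -, h₁⟩ := EntailsOk.veq_elim ih₁
    obtain ⟨d₂, d₂', hd₂, hd₂', -, -, h₂⟩ := EntailsOk.ceq_elim ih₂
    refine .ceq ih₁.1 (.handle ih₁.2.1.1 ih₂.2.1.1) (.handle ih₁.2.1.2 ih₂.2.1.2)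
      fun e e' he he' η η' hη hψ => ?_
    obtain rfl := he.unique (.handle hd₁ hd₂)
    obtain rfl := he'.unique (.handle hd₁' hd₂')
    exact h₁ η η' hη hψ _ _ (h₂ η η' hη hψ)
  | beta_tt _ _ _ ih ih₁ ih₂ =>
    obtain ⟨⟨d₁, hd₁, hr⟩, -⟩ := ih₁
    obtain ⟨⟨d₂, hd₂, -⟩, -⟩ := ih₂
    exact .ceq_of_den ih (.ite .tt hd₁ hd₂) hd₁ hr
  | beta_ff _ _ _ ih ih₁ ih₂ =>
    obtain ⟨⟨d₁, hd₁, -⟩, -⟩ := ih₁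
    obtain ⟨⟨d₂, hd₂, hr⟩, -⟩ := ih₂
    exact .ceq_of_den ih (.ite .ff hd₁ hd₂) hd₂ hr
  | beta_app _ _ _ ih ih₁ ih₂ =>
    obtain ⟨⟨d₁, hd₁, hr₁⟩, -⟩ := ih₁
    obtain ⟨⟨d₂, hd₂, hr₂⟩, -⟩ := ih₂
    exact .ceq_of_den ih (.app (.lam hd₁) hd₂) (hd₁.subst (.sub1 hd₂))
      fun η η' hη => hr₁ _ _ ⟨hη, hr₂ _ _ hη⟩
  | beta_bind_ret _ _ _ ih ih₁ ih₂ =>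
    obtain ⟨⟨d₁, hd₁, hr₁⟩, -⟩ := ih₁
    obtain ⟨⟨d₂, hd₂, hr₂⟩, -⟩ := ih₂
    exact .ceq_of_den ih (.bind (.ret hd₁) hd₂) (hd₂.subst (.sub1 hd₁))
      fun η η' hη => hr₂ _ _ ⟨hη, hr₁ _ _ hη⟩
  | beta_bind_op _ _ _ _ ih ih₁ ih₂ ih₃ => exact entails_beta_bind_op ih ih₁.1 ih₂.1 ih₃.1
  | beta_handle_ret _ _ _ ih ih₁ ih₂ => exact entails_beta_handle_ret ih ih₁.1 ih₂.1
  | beta_handle_op _ _ _ _ h ih ih₁ ih₂ ih₃ =>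
    exact entails_beta_handle_op ih ih₁.1 ih₂.1 ih₃.1 h
  | eta_unit _ _ ih₁ ih₂ =>
    obtain ⟨⟨d, hd, hr⟩, -⟩ := ih₂
    exact .veq_of_den ih₁ hd .unit hr
  | eta_bool _ _ _ ih ih₁ ih₂ => exact entails_eta_bool ih ih₁.1 ih₂.1
  | eta_fn _ _ ih₁ ih₂ =>
    obtain ⟨⟨d, hd, hr⟩, -⟩ := ih₂
    exact .veq_of_den ih₁ hd (.lam (.app (hd.rename (RenDen.succ _ _)) (.var .zero))) hr
  | eta_bind _ _ ih₁ ih₂ =>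
    obtain ⟨⟨d, hd, hr⟩, -⟩ := ih₂
    refine .ceq_of_den ih₁ ?_ hd hr
    convert CDen.bind hd (.ret (.var .zero)) using 1
    exact funext fun η => (lift_freeInterp_ret (d η)).symm
  | inherit _ _ he _ _ ih ih₁ ih₂ ih₃ =>
    exact entails_inherit ih ih₁ he (fun i B h => (ih₂ i B h).1) fun j => (ih₃ j).1
  | top_intro _ ih => exact ⟨ih, trivial, fun _ _ hη _ => hη⟩
  | bot_elim _ _ ih₁ ih₂ => exact ⟨ih₂.1, ih₁, fun η η' hη hψ => (ih₂.2.2 η η' hη hψ).elim⟩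
  | and_intro _ _ ih₁ ih₂ =>
    exact ⟨ih₁.1, ⟨ih₁.2.1, ih₂.2.1⟩,
      fun η η' hη hψ => ⟨ih₁.2.2 η η' hη hψ, ih₂.2.2 η η' hη hψ⟩⟩
  | and_left _ ih => exact ⟨ih.1, ih.2.1.1, fun η η' hη hψ => (ih.2.2 η η' hη hψ).1⟩
  | and_right _ ih => exact ⟨ih.1, ih.2.1.2, fun η η' hη hψ => (ih.2.2 η η' hη hψ).2⟩
  | or_left _ _ ih₁ ih₂ =>
    exact ⟨ih₂.1, ⟨ih₂.2.1, ih₁⟩, fun η η' hη hψ => .inl (ih₂.2.2 η η' hη hψ)⟩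
  | or_right _ _ ih₁ ih₂ =>
    exact ⟨ih₂.1, ⟨ih₁, ih₂.2.1⟩, fun η η' hη hψ => .inr (ih₂.2.2 η η' hη hψ)⟩
  | or_elim _ _ _ ih ih₁ ih₂ =>
    refine ⟨ih.1, ih₁.2.1, fun η η' hη hψ => ?_⟩
    rcases ih.2.2 η η' hη hψ with h | h
    · exact ih₁.2.2 η η' hη (List.forall_mem_cons.2 ⟨h, hψ⟩)
    · exact ih₂.2.2 η η' hη (List.forall_mem_cons.2 ⟨h, hψ⟩)
  | imp_intro _ _ _ ih₁ ih₂ ih₃ =>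
    exact ⟨ih₁, ⟨ih₂, ih₃.2.1⟩,
      fun η η' hη hψ h => ih₃.2.2 η η' hη (List.forall_mem_cons.2 ⟨h, hψ⟩)⟩
  | imp_elim _ _ ih₁ ih₂ =>
    exact ⟨ih₁.1, ih₁.2.1.2, fun η η' hη hψ => ih₁.2.2 η η' hη hψ (ih₂.2.2 η η' hη hψ)⟩
  | all_intro _ _ ih₁ ih₂ =>
    exact ⟨ih₁, ih₂.2.1, fun η η' hη hψ => EntailsOk.under ih₁ ih₂ hη hψ⟩
  | all_elim _ _ _ ih₁ ih₂ ih₃ =>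
    obtain ⟨d, hd, hs, hr, hr'⟩ := ih₂.1.sub1
    exact ⟨ih₃.1, Fm.Ok.subst ih₁ hs hr', fun η η' hη hψ =>
      (Fm.holds_subst ih₁ hs hr' hη).2 (ih₃.2.2 η η' hη hψ _ _ (hr _ _ hη))⟩
  | ex_intro _ _ _ ih₁ ih₂ ih₃ =>
    obtain ⟨d, hd, hs, hr, hr'⟩ := ih₂.1.sub1
    exact ⟨ih₃.1, ih₁, fun η η' hη hψ =>
      ⟨_, _, hr _ _ hη, (Fm.holds_subst ih₁ hs hr' hη).1 (ih₃.2.2 η η' hη hψ)⟩⟩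
  | @ex_elim Γ _ A _ _ _ _ _ ih₁ ih₂ ih₃ =>
    refine ⟨ih₂.1, ih₁, fun η η' hη hψ => ?_⟩
    obtain ⟨a, a', ha, h⟩ := ih₂.2.2 η η' hη hψ
    have hx : (Γ.cons A).rel (η, a) (η', a') := ⟨hη, ha⟩
    exact (Fm.holds_shift ih₁ (RenDen.succ Γ A) hx).1 (ih₃.2.2 _ _ hx
      (List.forall_mem_cons.2 ⟨h, holds_shiftHyps ih₂.1 (RenDen.succ Γ A) hx hψ⟩))
  -- Connectives are interpreted pointwise at a pair of environments, so classical reasoning carries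
  -- over directly.
  | em _ _ ih₁ ih₂ => exact ⟨ih₁, ⟨ih₂, ih₂, trivial⟩, fun _ _ _ _ => Classical.em _⟩
  | induction _ _ _ _ _ ih₁ ih₂ ih₃ ih₄ ih₅ =>
    exact entails_induction ih₁ ih₂.2 ih₂.1 ih₃ ih₄ ih₅

end LPred

-- The soundness theorem

theorem mainTheorem5 :
    LPred.SoundLogic
      (fun Γ h E S D => LPred.Provable (.respects Γ h E S D)) ∧
    ∀ (Γ : LPred.Ctx) (Ψ : List LPred.Fm) (φ : LPred.Fm),
      LPred.Provable (.entails Γ Ψ φ) →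
      ∀ η η' : Γ.env, Γ.rel η η' → (∀ ψ ∈ Ψ, ψ.holds Γ η η') → φ.holds Γ η η' := by
  refine ⟨fun Γ h E S D hR e he => ?_, fun Γ Ψ φ hφ => hφ.sem.2.2⟩
  obtain ⟨hE, H, hH, -, hHE⟩ := hR.sem
  obtain ⟨⟨t₁, h₁, -⟩, t₂, h₂, -⟩ := hE e he
  exact ⟨H, t₁, t₂, hH, h₁, h₂, fun η η' hη => hHE e he η η' hη t₁ t₂ h₁ h₂⟩
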